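/- Let $q\in(0,1)$. Identify partitions with Young diagrams; for a partition $\mu$ let $\mu'$ be its transpose, $\ell(\mu)$ its length, $|\mu|$ its size, $n(\mu)=\sum_i(i-1)\mu_i$, and let $S_\nu$ denote the Schur functions, regarded as functions on the real space $\ell^1$ of absolutely summable sequences $X=(x_1,x_2,\dots)$. Let $(q;q)_r=\prod_{i=1}^r(1-q^i)$ for $r\ge0$ and $1/(q;q)_r=0$ for integers $r<0$. The $q$-interpolation symmetric function with index $\mu$ is $$I_\mu(\,\cdot\,;q)=\sum_{\nu\subseteq\mu}\sigma(\mu,\nu;q)\,S_\nu,$$ $$\sigma(\mu,\nu;q)=(-1)^{|\mu|-|\nu|}\,q^{\,n(\mu)-n(\mu')-n(\nu)+n(\nu')}\det\left[\frac1{(q;q)_{\mu_i-\nu_k-i+k}}\right]_{i,k=1}^{\ell(\mu)}.$$ Let $\mathrm{Tab}(\mu)$ be the set of reverse tableaux of shape $\mu$, that is, fillings $T$ of the boxes $(i,j)$ of $\mu$ ($i$ the row, $j$ the column, both starting from $1$) by numbers from $\{1,2,\dots\}$ that weakly decrease along the rows from left to right and strictly decrease down the columns. Theorem. For every partition $\mu$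 and every $X=(x_1,x_2,\dots)\in\ell^1$, $$I_\mu(X;q)=\sum_{T\in\mathrm{Tab}(\mu)}\ \prod_{(i,j)\in\mu}\left(x_{T(i,j)}-q^{\,T(i,j)+i-j-1}\right),$$ where the series on the right converges absolutely. The same holds with the parentheses removed: the series $$\sum_{T\in\mathrm{Tab}(\mu)}\ \sum_{A\subseteq\mu}\ \prod_{(i,j)\in A}x_{T(i,j)}\prod_{(i,j)\in\mu\setminus A}\left(-q^{\,T(i,j)+i-j-1}\right),$$ whose terms are indexed by the pairs $(T,A)$ with $T\in\mathrm{Tab}(\mu)$ and $A$ a set of boxes of $\mu$, also converges absolutely to $I_\mu(X;q)$. -/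

import Mathlib

noncomputable section

namespace QInterp

/-! Conventions. A partition `μ` is a `YoungDiagram`, with boxes `(i, j)` (row, column), row lengths
`μ.rowLen i` and length `μ.colLen 0`. Rows, columns, variables and tableau entries are numbered
from `0`, so the variable `x 0` is the usual `x₁`, and so on. -/

/-- The weight (content) of a semistandard tableau: the exponent vector of the monomial
`∏_{(i, j)} x_{T(i, j)}`. -/
def weight {ν : YoungDiagram} (T : SemistandardYoungTableau ν) : ℕ →₀ ℕ :=
  ∑ c ∈ ν.cells, Finsupp.single (T c.1 c.2) 1

/-- The Schur function `S_ν` in the variables `x 0, x 1, …`, as a formal power series: the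
coefficient of `x ^ m` is the number of semistandard tableaux of shape `ν` and weight `m`. -/
def schur (ν : YoungDiagram) : MvPowerSeries ℕ ℝ :=
  fun m => (Nat.card {T : SemistandardYoungTableau ν // weight T = m} : ℝ)

/-- The value at the point `X` of the space `ℓ¹` of a series in the variables `x 0, x 1, …`
(for symmetric functions, which have bounded degree and bounded coefficients, this sum over
monomials converges absolutely on `ℓ¹`). -/
def eval (F : MvPowerSeries ℕ ℝ) (X : lp (fun _ : ℕ => ℝ) 1) : ℝ :=
  ∑' m : ℕ →₀ ℕ, MvPowerSeries.coeff m F * m.prod fun i k => X i ^ k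

/-- `n(μ) = ∑ (i - 1) μ_i` (with `i` starting from `1`). -/
def nStat (μ : YoungDiagram) : ℕ :=
  ∑ i ∈ Finset.range (μ.colLen 0), i * μ.rowLen i

/-- `1 / (q; q)_r`, equal to `0` for negative `r`. -/
def invPoch (q : ℝ) : ℤ → ℝ
  | Int.ofNat r => 1 / ∏ i ∈ Finset.range r, (1 - q * q ^ i)
  | Int.negSucc _ => 0

/-- The coefficients `σ(μ, ν; q)`. -/
def sigma (q : ℝ) (μ ν : YoungDiagram) : ℝ :=
  (-1) ^ ((μ.card : ℤ) - (ν.card : ℤ)) *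
    q ^ ((nStat μ : ℤ) - nStat μ.transpose - nStat ν + nStat ν.transpose) *
    Matrix.det (Matrix.of fun i k : Fin (μ.colLen 0) =>
      invPoch q ((μ.rowLen i : ℤ) - (ν.rowLen k : ℤ) - ((i : ℕ) : ℤ) + ((k : ℕ) : ℤ)))

theorem finite_subdiagrams (μ : YoungDiagram) : {ν : YoungDiagram | ν ≤ μ}.Finite := by
  refine Set.Finite.of_finite_image (f := YoungDiagram.cells) ?_ ?_
  · refine (μ.cells.powerset.finite_toSet).subset ?_
    rintro _ ⟨ν, hν, rfl⟩
    simpa using YoungDiagram.cells_subset_iff.2 hν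
  · intro a _ b _ h
    exact YoungDiagram.ext h

/-- The finite set of diagrams contained in `μ`. -/
def subdiagrams (μ : YoungDiagram) : Finset YoungDiagram :=
  (finite_subdiagrams μ).toFinset

/-- The `q`-interpolation symmetric function `I_μ( · ; q) = ∑_{ν ⊆ μ} σ(μ, ν; q) S_ν`. -/
def interpolation (q : ℝ) (μ : YoungDiagram) : MvPowerSeries ℕ ℝ :=
  ∑ ν ∈ subdiagrams μ, sigma q μ ν • schur ν

/-- Reverse tableaux of shape `μ`: entries weakly decrease along the rows from left to right and
strictly decrease down the columns. As for `SemistandardYoungTableau`, a tableau is a function on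
all pairs, required to vanish outside `μ`; the entry `n` stands for the usual entry `n + 1`. -/
@[ext]
structure ReverseTableau (μ : YoungDiagram) where
  entry : ℕ → ℕ → ℕ
  row_weak : ∀ {i j₁ j₂ : ℕ}, j₁ < j₂ → (i, j₂) ∈ μ → entry i j₂ ≤ entry i j₁
  col_strict : ∀ {i₁ i₂ j : ℕ}, i₁ < i₂ → (i₂, j) ∈ μ → entry i₂ j < entry i₁ j
  zeros : ∀ {i j : ℕ}, (i, j) ∉ μ → entry i j = 0

/-- The variable `x_{T(i, j)}` attached to the box `c = (i, j)`. -/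
def boxVar {μ : YoungDiagram} (X : lp (fun _ : ℕ => ℝ) 1) (T : ReverseTableau μ) (c : ℕ × ℕ) : ℝ :=
  X (T.entry c.1 c.2)

/-- The quantity `q^{T(i, j) + i - j - 1}` attached to the box `c = (i, j)`; here the entries start
from `0`, which absorbs the `-1`. -/
def boxShift {μ : YoungDiagram} (q : ℝ) (T : ReverseTableau μ) (c : ℕ × ℕ) : ℝ :=
  q ^ ((T.entry c.1 c.2 : ℤ) + (c.1 : ℤ) - (c.2 : ℤ))

/-- The term of the combinatorial series: `∏_{(i, j) ∈ μ} (x_{T(i, j)} - q^{T(i, j) + i - j - 1})`. -/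
def term {μ : YoungDiagram} (q : ℝ) (X : lp (fun _ : ℕ => ℝ) 1) (T : ReverseTableau μ) : ℝ :=
  ∏ c ∈ μ.cells, (boxVar X T c - boxShift q T c)

/-- The summand obtained on removing the parentheses in the product over boxes, by taking
`x_{T(i, j)}` in the boxes of `A` and `-q^{T(i, j) + i - j - 1}` in the other boxes. -/
def expandedTerm {μ : YoungDiagram} (q : ℝ) (X : lp (fun _ : ℕ => ℝ) 1) (T : ReverseTableau μ)
    (A : Finset (ℕ × ℕ)) : ℝ :=
  (∏ c ∈ A, boxVar X T c) * ∏ c ∈ μ.cells \ A, (-boxShift q T c)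

end QInterp

end

/-! The identity is the limit, as the number `N` of variables grows, of the expansion of factorial
Schur polynomials in ordinary Schur polynomials.

Keeping only the tableaux with entries `0, …, N - 1` (`tabSum`), the series on the right becomes
the factorial Schur polynomial in `X 0, …, X (N - 1)` with parameters `a_s = q^{N - 1 - s}`
(`sum_term_bounded`). Factorial Schur polynomials are ratios of alternants: `alternant_shifted` says
that the tableau sum times the Vandermonde determinant is `det[(x_i | a)^{l_j}]`, where
`(x | a)^m = (x - a_0) ⋯ (x - a_{m - 1})` and `l` is the strictly increasing sequence obtained from
the row lengths by adding a staircase. Both sides obey the same recursion in the number of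
variables: removing the entries `0` of a reverse tableau removes a horizontal strip (`tabSum_succ`),
and eliminating the first variable from the alternant gives a sum over interlacing sequences
(`alternant_succ`).

Expanding each `(x | a)^m` in powers of `x` and applying the Cauchy–Binet formula expands the
factorial Schur polynomial of `μ` in the Schur polynomials of the `ν ⊆ μ`, with coefficients
`det[c(l_j, k_i)]` (`tabSum_boxWeight_eq_sum`). For the parameters above, `c(m, k)` is given by the
`q`-binomial theorem (`fallCoeff_qParam`); the signs, powers of `q` and Pochhammer symbols come out
of the determinant, and what is left is `σ(μ, ν; q)` times a ratio of Pochhammer symbols that tends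
to `1` (`det_fallCoeff_qParam`, `tendsto_pochRatio`).

Finally, on `ℓ¹` each of the quantities attached to a box is bounded by a summable function of the
entry alone, so that the series over tableaux converge absolutely, and the finite sums above
converge to them. Schur functions are defined by semistandard tableaux with increasing entries; the two
conventions agree for finitely many variables, because complementing the entries reverses the order
of the variables and Schur polynomials are symmetric (`tabSum_boxWeight_zero_reverse`). -/

noncomputable section

namespace QInterp

open Finset Filter Topology

/-! ### Diagrams and reverse tableaux -/

theorem mem_subdiagrams {μ ν : YoungDiagram} : ν ∈ subdiagrams μ ↔ ν ≤ μ := by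
  simp [subdiagrams]

theorem le_iff_rowLen_le {μ ν : YoungDiagram} : ν ≤ μ ↔ ∀ i, ν.rowLen i ≤ μ.rowLen i := by
  constructor
  · intro h i
    by_contra! hlt
    exact lt_irrefl _ (YoungDiagram.mem_iff_lt_rowLen.1 (h (YoungDiagram.mem_iff_lt_rowLen.2 hlt)))
  · rintro h ⟨i, j⟩ hc
    exact YoungDiagram.mem_iff_lt_rowLen.2 ((YoungDiagram.mem_iff_lt_rowLen.1 hc).trans_le (h i))

theorem rowLen_eq_zero {μ : YoungDiagram} {N i : ℕ} (hμ : μ.colLen 0 ≤ N) (hi : N ≤ i) :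
    μ.rowLen i = 0 := by
  by_contra h
  have h1 : (i, 0) ∈ μ := YoungDiagram.mem_iff_lt_rowLen.2 (Nat.pos_of_ne_zero h)
  have := YoungDiagram.mem_iff_lt_colLen.1 h1
  omega

theorem colLen_zero_le {μ ν : YoungDiagram} (h : ν ≤ μ) : ν.colLen 0 ≤ μ.colLen 0 := by
  by_contra! hlt
  exact lt_irrefl _ (YoungDiagram.mem_iff_lt_colLen.1 (h (YoungDiagram.mem_iff_lt_colLen.2 hlt)))

theorem fst_lt_of_mem {μ : YoungDiagram} {N : ℕ} (hμ : μ.colLen 0 ≤ N) {c : ℕ × ℕ} (hc : c ∈ μ) :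
    c.1 < N := by
  have h : (c.1, 0) ∈ μ := μ.up_left_mem le_rfl (Nat.zero_le _) hc
  exact (YoungDiagram.mem_iff_lt_colLen.1 h).trans_le hμ

/-- A product over the boxes of a skew diagram, row by row. -/
@[to_additive]
theorem prod_cells_sdiff {M : Type*} [CommMonoid M] (μ ν : YoungDiagram) {N : ℕ}
    (hμ : μ.colLen 0 ≤ N) (f : ℕ → ℕ → M) :
    ∏ c ∈ μ.cells \ ν.cells, f c.1 c.2 =
      ∏ i ∈ range N, ∏ j ∈ Ico (ν.rowLen i) (μ.rowLen i), f i j := by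
  refine prod_finset_product' _ _ _ fun p => ?_
  have h1 : p ∈ μ ↔ p.2 < μ.rowLen p.1 := YoungDiagram.mem_iff_lt_rowLen
  have h2 : p ∈ ν ↔ p.2 < ν.rowLen p.1 := YoungDiagram.mem_iff_lt_rowLen
  have h3 : p ∈ μ → p.1 < N := fst_lt_of_mem hμ
  simp only [Finset.mem_sdiff, YoungDiagram.mem_cells, mem_range, mem_Ico]
  grind

namespace ReverseTableau

variable {μ : YoungDiagram}

theorem entry_anti (T : ReverseTableau μ) {i i' j j' : ℕ} (hi : i' ≤ i) (hj : j' ≤ j)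
    (hc : (i, j) ∈ μ) : T.entry i j ≤ T.entry i' j' := by
  have h1 : T.entry i j ≤ T.entry i' j := by
    rcases hi.eq_or_lt with rfl | h
    · exact le_rfl
    · exact (T.col_strict h hc).le
  refine h1.trans ?_
  rcases hj.eq_or_lt with rfl | h
  · exact le_rfl
  · exact T.row_weak h (μ.up_left_mem hi le_rfl hc)

theorem entry_add_le (T : ReverseTableau μ) {i j : ℕ} (hc : (i, j) ∈ μ) :
    T.entry i j + i ≤ T.entry 0 j := by
  induction i with
  | zero => simp
  | succ i ih =>
    have h := ih (μ.up_left_mem (Nat.le_succ i) le_rfl hc)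
    have := T.col_strict (Nat.lt_add_one i) hc
    omega

/-- A reverse tableau is determined by its entries in the boxes of its shape. -/
theorem restrict_injective :
    Function.Injective fun (T : ReverseTableau μ) (c : μ.cells) => T.entry c.1.1 c.1.2 := by
  intro T T' h
  ext i j
  by_cases hc : (i, j) ∈ μ
  · exact congrFun h ⟨(i, j), hc⟩
  · rw [T.zeros hc, T'.zeros hc]

theorem finite_bounded (N : ℕ) (μ : YoungDiagram) :
    {T : ReverseTableau μ | ∀ c ∈ μ.cells, T.entry c.1 c.2 < N}.Finite := by
  have h : {f : μ.cells → ℕ | ∀ c, f c ∈ Set.Iio N}.Finite :=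
    Set.Finite.pi' fun _ => Set.finite_Iio N
  refine (h.preimage (restrict_injective (μ := μ)).injOn).subset ?_
  exact fun T hT c => hT c.1 c.2

/-- The reverse tableaux of shape `μ` with entries `0, …, N - 1`. -/
def bounded (N : ℕ) (μ : YoungDiagram) : Finset (ReverseTableau μ) :=
  (finite_bounded N μ).toFinset

theorem mem_bounded {N : ℕ} {T : ReverseTableau μ} :
    T ∈ bounded N μ ↔ ∀ c ∈ μ.cells, T.entry c.1 c.2 < N := by
  simp [bounded]

/-- The boxes of `T` with nonzero entries. -/
def core (T : ReverseTableau μ) : YoungDiagram where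
  cells := {c ∈ μ.cells | 0 < T.entry c.1 c.2}
  isLowerSet := by
    rintro ⟨i, j⟩ ⟨i', j'⟩ h hc
    obtain ⟨hi, hj⟩ := Prod.mk_le_mk.1 h
    simp only [coe_filter, YoungDiagram.mem_cells, Set.mem_ofPred_eq] at hc ⊢
    exact ⟨μ.up_left_mem hi hj hc.1, hc.2.trans_le (T.entry_anti hi hj hc.1)⟩

theorem mem_core {T : ReverseTableau μ} {c : ℕ × ℕ} : c ∈ T.core ↔ 0 < T.entry c.1 c.2 := by
  refine mem_filter.trans ?_
  rw [YoungDiagram.mem_cells, and_iff_right_iff_imp]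
  intro h
  by_contra hc
  rw [T.zeros hc] at h
  exact lt_irrefl _ h

/-- The tableau on the boxes of `T` with nonzero entries obtained by decreasing all entries by
one. -/
def lower {lam : YoungDiagram} (T : ReverseTableau μ) (h : T.core = lam) : ReverseTableau lam where
  entry i j := T.entry i j - 1
  row_weak {i j₁ j₂} hj hc := by
    subst h
    have hμ : (i, j₂) ∈ μ := (mem_filter.1 hc).1
    have := T.row_weak hj hμ
    omega
  col_strict {i₁ i₂ j} hi hc := by
    subst h
    have hμ : (i₂, j) ∈ μ := (mem_filter.1 hc).1
    have h0 : 0 < T.entry i₂ j := mem_core.1 hc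
    have := T.col_strict hi hμ
    omega
  zeros {i j} hc := by
    subst h
    rw [mem_core] at hc
    simp only at hc
    omega

/-- The tableau of shape `μ` obtained from a tableau of smaller shape by increasing all entries by
one and filling the new boxes by `0`. -/
def raise {lam : YoungDiagram} (hle : lam ≤ μ) (hs : ∀ i j, (i + 1, j) ∈ μ → (i, j) ∈ lam)
    (T : ReverseTableau lam) : ReverseTableau μ where
  entry i j := if (i, j) ∈ lam then T.entry i j + 1 else 0
  row_weak {i j₁ j₂} hj hc := by
    by_cases h : (i, j₂) ∈ lam
    · rw [if_pos h, if_pos (lam.up_left_mem le_rfl hj.le h)]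
      exact Nat.succ_le_succ (T.row_weak hj h)
    · rw [if_neg h]
      exact Nat.zero_le _
  col_strict {i₁ i₂ j} hi hc := by
    rw [if_pos (hs i₁ j (μ.up_left_mem hi le_rfl hc))]
    split_ifs with h
    · exact Nat.succ_lt_succ (T.col_strict hi h)
    · exact Nat.succ_pos _
  zeros {i j} hc := if_neg fun h => hc (hle h)

theorem core_raise {lam : YoungDiagram} (hle : lam ≤ μ)
    (hs : ∀ i j, (i + 1, j) ∈ μ → (i, j) ∈ lam) (T : ReverseTableau lam) :
    (raise hle hs T).core = lam := by
  ext ⟨i, j⟩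
  rw [YoungDiagram.mem_cells, YoungDiagram.mem_cells, mem_core]
  by_cases h : (i, j) ∈ lam <;> simp [raise, h]

end ReverseTableau

/-- The sum over the reverse tableaux of shape `μ` with entries `0, …, N - 1` of the product over
the boxes of a weight `w t i j` depending on the entry `t` and the box `(i, j)`. -/
def tabSum {R : Type*} [CommRing R] (N : ℕ) (w : ℕ → ℕ → ℕ → R) (μ : YoungDiagram) : R :=
  ∑ T ∈ ReverseTableau.bounded N μ, ∏ c ∈ μ.cells, w (T.entry c.1 c.2) c.1 c.2

theorem map_tabSum {R S : Type*} [CommRing R] [CommRing S] (φ : R →+* S) (N : ℕ)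
    (w : ℕ → ℕ → ℕ → R) (μ : YoungDiagram) :
    φ (tabSum N w μ) = tabSum N (fun t i j => φ (w t i j)) μ := by
  simp [tabSum]

open Classical in
/-- The diagrams `lam` with at most `N` rows such that `μ / lam` is a horizontal strip. -/
def strips (N : ℕ) (μ : YoungDiagram) : Finset YoungDiagram :=
  {lam ∈ subdiagrams μ | lam.colLen 0 ≤ N ∧ ∀ i j, (i + 1, j) ∈ μ → (i, j) ∈ lam}

theorem mem_strips {N : ℕ} {μ lam : YoungDiagram} : lam ∈ strips N μ ↔
    lam ≤ μ ∧ lam.colLen 0 ≤ N ∧ ∀ i j, (i + 1, j) ∈ μ → (i, j) ∈ lam := by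
  simp [strips, mem_subdiagrams]

theorem core_mem_strips {N : ℕ} {μ : YoungDiagram} {T : ReverseTableau μ}
    (hT : T ∈ ReverseTableau.bounded (N + 1) μ) : T.core ∈ strips N μ := by
  rw [mem_strips]
  have hle : T.core ≤ μ := fun c hc => (mem_filter.1 hc).1
  refine ⟨hle, ?_, ?_⟩
  · by_contra! h
    have h1 : (N, 0) ∈ T.core := YoungDiagram.mem_iff_lt_colLen.2 h
    have h2 : 0 < T.entry N 0 := ReverseTableau.mem_core.1 h1
    have h3 := T.entry_add_le (hle h1)
    have h4 := ReverseTableau.mem_bounded.1 hT (0, 0)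
      (μ.up_left_mem (Nat.zero_le _) le_rfl (hle h1))
    simp only at h4
    omega
  · intro i j hc
    rw [ReverseTableau.mem_core]
    exact (Nat.zero_le _).trans_lt (T.col_strict (Nat.lt_succ_self i) hc)

/-- The branching rule: the boxes of a reverse tableau with entry `0` form a horizontal strip. -/
theorem tabSum_succ {R : Type*} [CommRing R] (N : ℕ) (w : ℕ → ℕ → ℕ → R) (μ : YoungDiagram) :
    tabSum (N + 1) w μ = ∑ lam ∈ strips N μ,
      (∏ c ∈ μ.cells \ lam.cells, w 0 c.1 c.2) * tabSum N (fun t => w (t + 1)) lam := by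
  classical
  rw [tabSum, ← sum_fiberwise_of_maps_to (fun T hT => core_mem_strips hT)]
  refine sum_congr rfl fun lam hlam => ?_
  obtain ⟨hle, -, hs⟩ := mem_strips.1 hlam
  rw [tabSum, mul_sum]
  refine sum_bij' (fun T hT => T.lower (mem_filter.1 hT).2)
    (fun T _ => ReverseTableau.raise hle hs T) ?_ ?_ ?_ ?_ ?_
  · intro T hT'
    obtain ⟨hT, rfl⟩ := mem_filter.1 hT'
    rw [ReverseTableau.mem_bounded] at hT ⊢
    intro c hc
    have h1 := hT c (hle hc)
    have h2 := ReverseTableau.mem_core.1 hc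
    simp only [ReverseTableau.lower]
    omega
  · intro T hT
    rw [mem_filter, ReverseTableau.mem_bounded]
    refine ⟨fun c hc => ?_, ReverseTableau.core_raise hle hs T⟩
    simp only [ReverseTableau.raise]
    split_ifs with h
    · exact Nat.succ_lt_succ (ReverseTableau.mem_bounded.1 hT c h)
    · exact Nat.succ_pos _
  · intro T hT
    obtain ⟨hT, rfl⟩ := mem_filter.1 hT
    ext i j
    simp only [ReverseTableau.raise, ReverseTableau.lower, ReverseTableau.mem_core]
    split_ifs <;> omega
  · intro T hT
    ext i j
    simp only [ReverseTableau.raise, ReverseTableau.lower]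
    split_ifs with h
    · rfl
    · rw [T.zeros h]
  · intro T hT
    obtain ⟨hT, rfl⟩ := mem_filter.1 hT
    rw [← prod_sdiff (YoungDiagram.cells_subset_iff.2 hle)]
    congr 1
    · refine prod_congr rfl fun c hc => ?_
      have h : c ∉ T.core := (Finset.mem_sdiff.1 hc).2
      rw [ReverseTableau.mem_core] at h
      rw [Nat.eq_zero_of_not_pos h]
    · refine prod_congr rfl fun c hc => ?_
      have h : 0 < T.entry c.1 c.2 := ReverseTableau.mem_core.1 hc
      simp only [ReverseTableau.lower, Nat.sub_add_cancel h]

/-- The row lengths of `μ`, read from the `N`-th row upwards and made strictly increasing by adding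
the staircase. -/
def shifted (N : ℕ) (μ : YoungDiagram) (j : Fin N) : ℕ :=
  μ.rowLen (N - 1 - j) + j

theorem shifted_strictMono (N : ℕ) (μ : YoungDiagram) : StrictMono (shifted N μ) := by
  intro i j h
  have h1 : (i : ℕ) < j := h
  have := μ.rowLen_anti (N - 1 - j) (N - 1 - i) (by omega)
  simp only [shifted]
  omega

theorem rowLen_eq_shifted {N i : ℕ} (μ : YoungDiagram) (hi : i < N) :
    μ.rowLen i + (N - 1 - i) = shifted N μ ⟨N - 1 - i, by omega⟩ := by
  simp only [shifted]
  congr 2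
  omega

theorem le_iff_shifted_le {N : ℕ} {μ ν : YoungDiagram} (hν : ν.colLen 0 ≤ N) :
    ν ≤ μ ↔ ∀ j, shifted N ν j ≤ shifted N μ j := by
  rw [le_iff_rowLen_le]
  constructor
  · exact fun h j => Nat.add_le_add_right (h _) _
  · intro h i
    rcases lt_or_ge i N with hi | hi
    · have := h ⟨N - 1 - i, by omega⟩
      rw [← rowLen_eq_shifted ν hi, ← rowLen_eq_shifted μ hi] at this
      omega
    · rw [rowLen_eq_zero hν hi]
      exact Nat.zero_le _

theorem shifted_injOn {N : ℕ} {μ ν : YoungDiagram} (hμ : μ.colLen 0 ≤ N) (hν : ν.colLen 0 ≤ N)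
    (h : shifted N μ = shifted N ν) : μ = ν :=
  le_antisymm ((le_iff_shifted_le hμ).2 fun j => (congrFun h j).le)
    ((le_iff_shifted_le hν).2 fun j => (congrFun h j).ge)

theorem strictMono_sub_monotone {N : ℕ} {l : Fin N → ℕ} (hl : StrictMono l) {i j : Fin N}
    (hij : i ≤ j) : l i + (j - i : ℕ) ≤ l j := by
  obtain ⟨i, hi⟩ := i
  obtain ⟨j, hj⟩ := j
  have hij : i ≤ j := hij
  induction j, hij using Nat.le_induction with
  | base => simp
  | succ j hle ih =>
    have h1 := ih (by omega) hle
    have h2 : l ⟨j, by omega⟩ < l ⟨j + 1, hj⟩ := hl (Nat.lt_succ_self j)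
    simp only at h1 h2 ⊢
    omega

/-- Every strictly increasing sequence of length `N` comes from a partition with at most `N`
rows. -/
theorem exists_shifted_eq {N : ℕ} {l : Fin N → ℕ} (hl : StrictMono l) :
    ∃ μ : YoungDiagram, μ.colLen 0 ≤ N ∧ shifted N μ = l := by
  -- The row lengths: read `l` backwards and remove the staircase.
  let r : ℕ → ℕ := fun i => if h : i < N then l ⟨N - 1 - i, by omega⟩ - (N - 1 - i) else 0
  have hr : ∀ i i', i ≤ i' → r i' ≤ r i := by
    intro i i' h
    simp only [r]
    split_ifs with h1 h2 h2
    · have := strictMono_sub_monotone hl (i := ⟨N - 1 - i', by omega⟩)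
        (j := ⟨N - 1 - i, by omega⟩) (by simp only [Fin.mk_le_mk]; omega)
      simp only at this
      omega
    · omega
    · omega
    · omega
  let μ : YoungDiagram :=
    { cells := (range N ×ˢ range (r 0)).filter fun c => c.2 < r c.1
      isLowerSet := by
        rintro ⟨i, j⟩ ⟨i', j'⟩ h hc
        obtain ⟨hi, hj⟩ := Prod.mk_le_mk.1 h
        simp only [coe_filter, mem_product, mem_range, Set.mem_ofPred_eq] at hc ⊢
        have := hr i' i hi
        omega }
  have hmem : ∀ i j, (i, j) ∈ μ ↔ j < r i := by
    intro i j
    refine mem_filter.trans ?_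
    simp only [mem_product, mem_range, and_iff_right_iff_imp]
    intro h
    refine ⟨?_, h.trans_le (hr 0 i (Nat.zero_le _))⟩
    by_contra hN
    simp [r, hN] at h
  have hrow : ∀ i, μ.rowLen i = r i := by
    intro i
    refine le_antisymm ?_ ?_
    · by_contra! h
      exact lt_irrefl _ ((hmem _ _).1 (YoungDiagram.mem_iff_lt_rowLen.2 h))
    · by_contra! h
      exact lt_irrefl _ (YoungDiagram.mem_iff_lt_rowLen.1 ((hmem _ _).2 h))
  refine ⟨μ, ?_, ?_⟩
  · by_contra! h
    have := (hmem _ _).1 (YoungDiagram.mem_iff_lt_colLen.2 h)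
    simp [r] at this
  · funext j
    have hj := j.2
    have h1 := strictMono_sub_monotone hl (i := ⟨0, by omega⟩) (j := j) (Nat.zero_le _)
    have h2 : (⟨N - 1 - (N - 1 - j), by omega⟩ : Fin N) = j := by
      ext
      simp only
      omega
    rw [shifted, hrow]
    simp only [r]
    rw [dif_pos (by omega), h2]
    simp only at h1
    omega

/-- Interlacing of row lengths in terms of the shifted sequences. -/
theorem mem_strips_iff {N : ℕ} {μ lam : YoungDiagram} (hμ : μ.colLen 0 ≤ N + 1)
    (hlam : lam.colLen 0 ≤ N) :
    lam ∈ strips N μ ↔ shifted N lam ∈ Fintype.piFinset fun j : Fin N =>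
      Ico (shifted (N + 1) μ j.castSucc) (shifted (N + 1) μ j.succ) := by
  have hrows : lam ∈ strips N μ ↔
      ∀ i, lam.rowLen i ≤ μ.rowLen i ∧ μ.rowLen (i + 1) ≤ lam.rowLen i := by
    rw [mem_strips, le_iff_rowLen_le, forall_and]
    refine and_congr Iff.rfl ?_
    simp only [hlam, true_and, YoungDiagram.mem_iff_lt_rowLen]
    exact forall_congr' fun i => ⟨fun h => le_of_forall_lt h, fun h j hj => hj.trans_le h⟩
  rw [hrows, Fintype.mem_piFinset]
  have key : ∀ j : Fin N, shifted N lam j ∈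
      Ico (shifted (N + 1) μ j.castSucc) (shifted (N + 1) μ j.succ) ↔
      lam.rowLen (N - 1 - j) ≤ μ.rowLen (N - 1 - j) ∧
        μ.rowLen (N - 1 - j + 1) ≤ lam.rowLen (N - 1 - j) := by
    intro j
    have hj := j.2
    have h1 : N + 1 - 1 - (j : ℕ) = N - 1 - j + 1 := by omega
    have h2 : N + 1 - 1 - ((j : ℕ) + 1) = N - 1 - j := by omega
    simp only [shifted, mem_Ico, Fin.val_castSucc, Fin.val_succ, h1, h2]
    omega
  simp only [key]
  constructor
  · exact fun h j => h _
  · intro h i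
    rcases lt_or_ge i N with hi | hi
    · have := h ⟨N - 1 - i, by omega⟩
      simpa only [show N - 1 - (N - 1 - i) = i by omega] using this
    · rw [rowLen_eq_zero hlam hi, rowLen_eq_zero hμ (Nat.succ_le_succ hi)]
      exact ⟨Nat.zero_le _, le_rfl⟩

/-! ### Alternants and the bialternant formula -/

section Alternant

variable {R : Type*} [CommRing R]

/-- The generalized power `(x | a)^m = (x - a 0) ⋯ (x - a (m - 1))`. -/
def fallProd (a : ℤ → R) (m : ℕ) (x : R) : R :=
  ∏ s ∈ range m, (x - a s)

/-- The alternant `det[(x_i | a)^{l_j}]`. -/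
def alternant {N : ℕ} (a : ℤ → R) (l : Fin N → ℕ) (x : Fin N → R) : R :=
  Matrix.det (Matrix.of fun i j => fallProd a (l j) (x i))

/-- A Newton-type divided difference for generalized powers. -/
theorem fallProd_sub (a : ℤ → R) {l m : ℕ} (h : l ≤ m) (y z : R) :
    fallProd a m y - (∏ s ∈ Ico l m, (z - a s)) * fallProd a l y =
      (y - z) * ∑ p ∈ Ico l m, fallProd a p y * ∏ s ∈ Ico (p + 1) m, (z - a s) := by
  induction m, h using Nat.le_induction with
  | base => simp
  | succ m hm ih =>
    have h1 : fallProd a (m + 1) y = fallProd a m y * (y - a m) := prod_range_succ _ _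
    have h2 : ∑ p ∈ Ico l m, fallProd a p y * ∏ s ∈ Ico (p + 1) (m + 1), (z - a s) =
        (∑ p ∈ Ico l m, fallProd a p y * ∏ s ∈ Ico (p + 1) m, (z - a s)) * (z - a m) := by
      rw [sum_mul]
      refine sum_congr rfl fun p hp => ?_
      rw [prod_Ico_succ_top (by have := (mem_Ico.1 hp).2; omega), mul_assoc]
    rw [h1, prod_Ico_succ_top hm, sum_Ico_succ_top hm, h2, Ico_self, prod_empty]
    linear_combination (z - a m) * ih

/-- Multilinearity of the determinant in the columns. -/
theorem det_sum_columns {N : ℕ} (S : Fin N → Finset ℕ) (g : Fin N → ℕ → R)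
    (f : Fin N → ℕ → R) :
    Matrix.det (Matrix.of fun i j => ∑ p ∈ S j, g j p * f i p) =
      ∑ p ∈ Fintype.piFinset S, (∏ j, g j (p j)) * Matrix.det (Matrix.of fun i j => f i (p j)) := by
  rw [← Matrix.det_transpose]
  have h := (Matrix.detRowAlternating (R := R) (n := Fin N)).toMultilinearMap.map_sum_finset
    (fun j p => g j p • fun i => f i p) S
  have h0 : (Matrix.of fun i j => ∑ p ∈ S j, g j p * f i p).transpose =
      fun j => ∑ p ∈ S j, g j p • fun i => f i p := by
    ext j i
    simp
  rw [h0]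
  refine h.trans (sum_congr rfl fun p _ => ?_)
  rw [MultilinearMap.map_smul_univ, smul_eq_mul]
  congr 1
  exact Matrix.det_transpose _

/-- The branching rule for alternants: subtracting from each column a multiple of its predecessor
clears the first row except for its first entry, and the divided differences left in the other rows
expand into alternants of the sequences interlacing with `l`. -/
theorem alternant_succ {N : ℕ} (a : ℤ → R) (l : Fin (N + 1) → ℕ) (hl : StrictMono l)
    (x : Fin (N + 1) → R) :
    alternant a l x = (∏ i : Fin N, (x i.succ - x 0)) *
      ∑ p ∈ Fintype.piFinset fun j : Fin N => Ico (l j.castSucc) (l j.succ),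
        (fallProd a (l 0) (x 0) * ∏ j, ∏ s ∈ Ico (p j + 1) (l j.succ), (x 0 - a s)) *
          alternant a p fun i => x i.succ := by
  let c : Fin N → R := fun j => ∏ s ∈ Ico (l j.castSucc) (l j.succ), (x 0 - a s)
  let B : Matrix (Fin (N + 1)) (Fin (N + 1)) R := Matrix.of fun i => Fin.cons
    (fallProd a (l 0) (x i))
    fun j => fallProd a (l j.succ) (x i) - c j * fallProd a (l j.castSucc) (x i)
  -- `B` results from the column operations; its first row vanishes off the first column.
  have hB : ∀ i (j : Fin N), B i j.succ = (x i - x 0) * ∑ p ∈ Ico (l j.castSucc) (l j.succ),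
      (∏ s ∈ Ico (p + 1) (l j.succ), (x 0 - a s)) * fallProd a p (x i) := by
    intro i j
    simp only [mul_comm (∏ s ∈ Ico (_ + 1) _, _) (fallProd _ _ _)]
    rw [← fallProd_sub a (hl j.castSucc_lt_succ).le]
    rfl
  have hdet : alternant a l x = B.det := by
    refine Matrix.det_eq_of_forall_col_eq_smul_add_pred c (fun i => rfl) fun i j => ?_
    change _ = (fallProd a (l j.succ) (x i) - c j * fallProd a (l j.castSucc) (x i)) +
      c j * fallProd a (l j.castSucc) (x i)
    rw [sub_add_cancel]
    rfl
  have hsub : B.submatrix Fin.succ Fin.succ = Matrix.of fun i j => (x i.succ - x 0) *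
      (Matrix.of fun (i : Fin N) (j : Fin N) => ∑ p ∈ Ico (l j.castSucc) (l j.succ),
        (∏ s ∈ Ico (p + 1) (l j.succ), (x 0 - a s)) * fallProd a p (x i.succ)) i j := by
    ext i j
    exact hB _ _
  rw [hdet, Matrix.det_succ_row_zero, Fin.sum_univ_succ, sum_eq_zero, add_zero]
  · have h0 : B 0 0 = fallProd a (l 0) (x 0) := rfl
    have h1 : B.submatrix Fin.succ (Fin.succAbove 0) = B.submatrix Fin.succ Fin.succ := by
      congr 1
    rw [h1, hsub, Matrix.det_mul_column, det_sum_columns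
      (fun j : Fin N => Ico (l j.castSucc) (l j.succ))
      (fun j p => ∏ s ∈ Ico (p + 1) (l j.succ), (x 0 - a s)), h0]
    simp only [Fin.val_zero, pow_zero, one_mul, mul_sum]
    refine sum_congr rfl fun p _ => ?_
    rw [alternant]
    ring
  · intro j _
    rw [hB]
    simp

/-- The weight `x_t - a_{N - 1 - t - i + j}` of the entry `t` in the box `(i, j)`, for `N`
variables. -/
def boxWeight (a : ℤ → R) (x : ℕ → R) (N : ℕ) (t i j : ℕ) : R :=
  x t - a ((N : ℤ) - 1 - t - i + j)

/-- The boxes of a horizontal strip, grouped by rows, give the coefficient of the branching rule for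
alternants. -/
theorem prod_strip (a : ℤ → R) (x : ℕ → R) {N : ℕ} {μ lam : YoungDiagram}
    (hμ : μ.colLen 0 ≤ N + 1) (hlam : lam.colLen 0 ≤ N) :
    ∏ c ∈ μ.cells \ lam.cells, boxWeight a x (N + 1) 0 c.1 c.2 =
      fallProd a (shifted (N + 1) μ 0) (x 0) * ∏ j : Fin N,
        ∏ s ∈ Ico (shifted N lam j + 1) (shifted (N + 1) μ j.succ), (x 0 - a s) := by
  rw [prod_cells_sdiff μ lam hμ, prod_range_succ, mul_comm, ← prod_range_reflect]
  congr 1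
  · rw [rowLen_eq_zero hlam le_rfl, ← range_eq_Ico]
    simp only [shifted, fallProd, boxWeight, Fin.val_zero, add_zero, Nat.sub_zero,
      Nat.add_sub_cancel]
    refine prod_congr rfl fun j _ => ?_
    congr 2
    push_cast
    ring
  · rw [← Fin.prod_univ_eq_prod_range (fun j => ∏ k ∈ Ico (lam.rowLen (N - 1 - j))
      (μ.rowLen (N - 1 - j)), boxWeight a x (N + 1) 0 (N - 1 - j) k)]
    refine prod_congr rfl fun j _ => ?_
    have hj := j.2
    have h2 : N + 1 - 1 - ((j : ℕ) + 1) = N - 1 - j := by omega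
    simp only [shifted, Fin.val_succ, h2, add_assoc]
    rw [← prod_Ico_add' (fun s : ℕ => x 0 - a s)]
    refine prod_congr rfl fun k _ => ?_
    simp only [boxWeight]
    congr 2
    have : ((N - 1 - j : ℕ) : ℤ) = N - 1 - j := by omega
    rw [this]
    push_cast
    ring

/-- The bialternant formula for factorial Schur polynomials: the tableau sum times the Vandermonde
determinant is an alternant. -/
theorem alternant_shifted (a : ℤ → R) (N : ℕ) (x : ℕ → R) (μ : YoungDiagram)
    (hμ : μ.colLen 0 ≤ N) :
    alternant a (shifted N μ) (fun i => x i) =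
      (Matrix.vandermonde fun i : Fin N => x i).det * tabSum N (boxWeight a x N) μ := by
  induction N generalizing μ x with
  | zero =>
    have hempty : μ.cells = ∅ := by
      refine eq_empty_of_forall_notMem fun c hc => ?_
      exact Nat.not_lt_zero _ (fst_lt_of_mem hμ hc)
    have hnot : ∀ c, c ∉ μ := fun c hc => by
      have : c ∈ μ.cells := hc
      simp [hempty] at this
    have hcard : ReverseTableau.bounded 0 μ =
        {⟨fun _ _ => 0, fun _ _ => le_rfl, fun _ h => absurd h (hnot _), fun _ => rfl⟩} := by
      ext T
      rw [ReverseTableau.mem_bounded, mem_singleton, hempty]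
      refine ⟨fun _ => ?_, fun _ => by simp⟩
      ext i j
      exact T.zeros (hnot _)
    rw [tabSum, hcard, sum_singleton, hempty, prod_empty, alternant, Matrix.det_isEmpty,
      Matrix.det_isEmpty, mul_one]
  | succ N ih =>
    have hvand : (Matrix.vandermonde fun i : Fin (N + 1) => x i).det =
        (∏ i : Fin N, (x (i.succ : Fin (N + 1)) - x (0 : Fin (N + 1)))) *
          (Matrix.vandermonde fun i : Fin N => x (i + 1)).det := by
      rw [Matrix.det_vandermonde, Fin.prod_univ_succ, Matrix.det_vandermonde]
      simp only [Fin.prod_Ioi_zero, Fin.prod_Ioi_succ]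
      rfl
    rw [alternant_succ a _ (shifted_strictMono _ _), hvand, mul_assoc, tabSum_succ]
    congr 1
    rw [mul_sum]
    symm
    refine sum_bij (fun lam _ => shifted N lam) ?_ ?_ ?_ ?_
    · intro lam hlam
      exact (mem_strips_iff hμ (mem_strips.1 hlam).2.1).1 hlam
    · intro lam hlam lam' hlam' h
      exact shifted_injOn (mem_strips.1 hlam).2.1 (mem_strips.1 hlam').2.1 h
    · intro p hp
      have hmono : StrictMono p := by
        intro i j hij
        have h1 := (mem_Ico.1 (Fintype.mem_piFinset.1 hp i)).2
        have h2 := (mem_Ico.1 (Fintype.mem_piFinset.1 hp j)).1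
        have h3 : i.succ ≤ j.castSucc := hij
        exact h1.trans_le (((shifted_strictMono _ _).monotone h3).trans h2)
      obtain ⟨lam, hlam, rfl⟩ := exists_shifted_eq hmono
      exact ⟨lam, (mem_strips_iff hμ hlam).2 hp, rfl⟩
    · intro lam hlam
      have hN := (mem_strips.1 hlam).2.1
      have hw : (fun t => boxWeight a x (N + 1) (t + 1)) =
          boxWeight a (fun t => x (t + 1)) N := by
        funext t i j
        simp only [boxWeight]
        congr 2
        push_cast
        ring
      have h := ih (fun t => x (t + 1)) lam hN
      rw [prod_strip a x hμ hN, hw]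
      simp only [Fin.val_succ, Fin.val_zero]
      rw [h]
      ring

end Alternant

/-! ### Expansion in Schur polynomials -/

section Expansion

variable {R : Type*} [CommRing R]

/-- The Cauchy–Binet formula. -/
theorem det_mul_eq_sum_strictMono {N M : ℕ} (A : Matrix (Fin N) (Fin M) R)
    (B : Matrix (Fin M) (Fin N) R) :
    (A * B).det = ∑ f : Fin N → Fin M with StrictMono f,
      (A.submatrix id f).det * (B.submatrix f id).det := by
  classical
  have h0 : (A * B).det = ∑ g : Fin N → Fin M, (∏ i, A i (g i)) * (B.submatrix g id).det := by
    have h := (Matrix.detRowAlternating (R := R) (n := Fin N)).toMultilinearMap.map_sum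
      (fun i k => A i k • B k)
    have h1 : A * B = fun i => ∑ k, A i k • B k := by
      ext i j
      simp [Matrix.mul_apply]
    rw [h1]
    refine h.trans (sum_congr rfl fun g _ => ?_)
    rw [MultilinearMap.map_smul_univ, smul_eq_mul]
    rfl
  have h1 : ∑ g : Fin N → Fin M, (∏ i, A i (g i)) * (B.submatrix g id).det =
      ∑ g : Fin N → Fin M with Function.Injective g,
        (∏ i, A i (g i)) * (B.submatrix g id).det := by
    symm
    refine sum_filter_of_ne fun g _ hg => ?_
    by_contra hinj
    refine hg ?_
    simp only [Function.Injective, not_forall] at hinj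
    obtain ⟨i, j, hij, hne⟩ := hinj
    rw [Matrix.det_zero_of_row_eq hne, mul_zero]
    funext k
    simp [hij]
  rw [h0, h1]
  have h2 : ∀ f : Fin N → Fin M, (A.submatrix id f).det * (B.submatrix f id).det =
      ∑ σ : Equiv.Perm (Fin N), (∏ i, A i (f (σ i))) * (B.submatrix (f ∘ σ) id).det := by
    intro f
    rw [← Matrix.det_transpose, Matrix.det_apply, sum_mul]
    refine sum_congr rfl fun σ _ => ?_
    have h3 : B.submatrix (f ∘ σ) id = (B.submatrix f id).submatrix σ id := rfl
    rw [h3, Matrix.det_permute, Units.smul_def, zsmul_eq_mul]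
    simp only [Matrix.transpose_apply, Matrix.submatrix_apply, id]
    ring
  simp only [h2]
  rw [sum_sigma']
  symm
  refine sum_bij (fun p _ => p.1 ∘ p.2) ?_ ?_ ?_ ?_
  · rintro ⟨f, σ⟩ hp
    simp only [mem_sigma, mem_filter, mem_univ, true_and, and_true] at hp ⊢
    exact hp.injective.comp σ.injective
  · rintro ⟨f, σ⟩ hp ⟨f', σ'⟩ hp' h
    simp only [mem_sigma, mem_filter, mem_univ, true_and, and_true] at hp hp' h
    have hr : Set.range f = Set.range f' := by
      rw [← σ.surjective.range_comp f, h, σ'.surjective.range_comp f']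
    obtain rfl : f = f' := (hp.range_inj hp').1 hr
    congr 1
    ext i
    rw [hp.injective (congrFun h i)]
  · intro g hg
    simp only [mem_filter, mem_univ, true_and] at hg
    refine ⟨⟨g ∘ Tuple.sort g, (Tuple.sort g)⁻¹⟩, ?_, ?_⟩
    · simp only [mem_sigma, mem_filter, mem_univ, true_and, and_true]
      exact (Tuple.monotone_sort g).strictMono_of_injective (hg.comp (Tuple.sort g).injective)
    · funext i
      simp
  · rintro ⟨f, σ⟩ _
    rfl

/-- The coefficient of `x^k` in the generalized power `(x | a)^m`. -/
def fallCoeff (a : ℤ → R) (m k : ℕ) : R :=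
  (∏ s ∈ range m, (Polynomial.X - Polynomial.C (a s))).coeff k

theorem natDegree_fall_le (a : ℤ → R) (m : ℕ) :
    (∏ s ∈ range m, (Polynomial.X - Polynomial.C (a s))).natDegree ≤ m := by
  refine (Polynomial.natDegree_prod_le _ _).trans ?_
  refine (sum_le_card_nsmul _ _ 1 fun s _ => Polynomial.natDegree_X_sub_C_le _).trans ?_
  simp

theorem fallCoeff_eq_zero (a : ℤ → R) {m k : ℕ} (h : m < k) : fallCoeff a m k = 0 :=
  Polynomial.coeff_eq_zero_of_natDegree_lt ((natDegree_fall_le a m).trans_lt h)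

theorem fallProd_eq_sum (a : ℤ → R) {m M : ℕ} (h : m < M) (x : R) :
    fallProd a m x = ∑ k : Fin M, x ^ (k : ℕ) * fallCoeff a m k := by
  rw [Fin.sum_univ_eq_sum_range (fun k => x ^ k * fallCoeff a m k)]
  have h1 := Polynomial.eval_eq_sum_range' ((natDegree_fall_le a m).trans_lt h) x
  rw [Polynomial.eval_prod] at h1
  simp only [Polynomial.eval_sub, Polynomial.eval_X, Polynomial.eval_C] at h1
  rw [fallProd, h1]
  exact sum_congr rfl fun k _ => mul_comm _ _

theorem map_fallCoeff {S : Type*} [CommRing S] (φ : R →+* S) (a : ℤ → R) (m k : ℕ) :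
    fallCoeff (fun s => φ (a s)) m k = φ (fallCoeff a m k) := by
  rw [fallCoeff, fallCoeff, ← Polynomial.coeff_map, Polynomial.map_prod]
  simp

theorem fallProd_zero (m : ℕ) (x : R) : fallProd (0 : ℤ → R) m x = x ^ m := by
  simp [fallProd]

/-- Only the partitions contained in `μ` contribute to the expansion: the determinant vanishes as
soon as one entry of `k` exceeds the corresponding entry of `l`. -/
theorem det_fallCoeff_eq_zero {N : ℕ} (a : ℤ → R) {l k : Fin N → ℕ} (hl : StrictMono l)
    (hk : StrictMono k) {j : Fin N} (hj : l j < k j) :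
    Matrix.det (Matrix.of fun i j => fallCoeff a (l j) (k i)) = 0 := by
  rw [Matrix.det_apply]
  refine sum_eq_zero fun σ _ => ?_
  -- By the pigeonhole principle `σ` cannot map `{i ≤ j}` into `{i < j}`.
  obtain ⟨i, hi, hσ⟩ : ∃ i, i ≤ j ∧ j ≤ σ i := by
    by_contra! h
    have h1 : (Iic j).card ≤ (Iio j).card :=
      card_le_card_of_injOn σ (fun i hi => mem_coe.2 (mem_Iio.2 (h i (mem_Iic.1 hi))))
        σ.injective.injOn
    simp at h1
  rw [prod_eq_zero (mem_univ i), smul_zero]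
  exact fallCoeff_eq_zero a
    ((hl.monotone hi).trans_lt (hj.trans_le (hk.monotone hσ)))

/-- The expansion of an alternant in ordinary alternants, by the Cauchy–Binet formula. -/
theorem alternant_eq_sum (a : ℤ → R) {N M : ℕ} {l : Fin N → ℕ} (hM : ∀ j, l j < M)
    (x : Fin N → R) :
    alternant a l x = ∑ f : Fin N → Fin M with StrictMono f,
      Matrix.det (Matrix.of fun i j => fallCoeff a (l j) (f i)) *
        alternant 0 (fun j => f j) x := by
  have h : (Matrix.of fun i j => fallProd a (l j) (x i)) =
      (Matrix.of fun (i : Fin N) (k : Fin M) => x i ^ (k : ℕ)) *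
        Matrix.of fun (k : Fin M) (j : Fin N) => fallCoeff a (l j) k := by
    ext i j
    rw [Matrix.mul_apply]
    exact fallProd_eq_sum a (hM j) (x i)
  rw [alternant, h, det_mul_eq_sum_strictMono]
  refine sum_congr rfl fun f _ => ?_
  rw [mul_comm, alternant]
  simp only [fallProd_zero]
  rfl

/-- The same expansion, indexed by the diagrams contained in `μ`. -/
theorem alternant_shifted_eq_sum (a : ℤ → R) {N : ℕ} (x : Fin N → R) (μ : YoungDiagram)
    (hμ : μ.colLen 0 ≤ N) :
    alternant a (shifted N μ) x = ∑ ν ∈ subdiagrams μ,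
      Matrix.det (Matrix.of fun i j => fallCoeff a (shifted N μ j) (shifted N ν i)) *
        alternant 0 (shifted N ν) x := by
  have hM : ∀ j, shifted N μ j < μ.rowLen 0 + N := fun j =>
    Nat.add_lt_add_of_le_of_lt (μ.rowLen_anti _ _ (Nat.zero_le _)) j.2
  rw [alternant_eq_sum a hM]
  symm
  have hle : ∀ ν ∈ subdiagrams μ, ∀ j, shifted N ν j ≤ shifted N μ j := fun ν hν =>
    (le_iff_shifted_le ((colLen_zero_le (mem_subdiagrams.1 hν)).trans hμ)).1
      (mem_subdiagrams.1 hν)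
  refine sum_bij_ne_zero
    (fun ν hν _ j => ⟨shifted N ν j, (hle ν hν j).trans_lt (hM j)⟩) ?_ ?_ ?_ ?_
  · intro ν hν _
    rw [mem_filter]
    exact ⟨mem_univ _, fun _ _ hij => shifted_strictMono N ν hij⟩
  · intro ν hν _ ν' hν' _ h
    refine shifted_injOn ((colLen_zero_le (mem_subdiagrams.1 hν)).trans hμ)
      ((colLen_zero_le (mem_subdiagrams.1 hν')).trans hμ) ?_
    funext j
    exact congrArg Fin.val (congrFun h j)
  · intro f hf hne
    have hmono : StrictMono fun j => (f j : ℕ) := (mem_filter.1 hf).2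
    obtain ⟨ν, hν, hνf⟩ := exists_shifted_eq hmono
    have hsub : ν ∈ subdiagrams μ := by
      rw [mem_subdiagrams, le_iff_shifted_le hν, hνf]
      intro j
      by_contra! hj
      refine hne ?_
      rw [det_fallCoeff_eq_zero a (shifted_strictMono N μ) hmono hj, zero_mul]
    refine ⟨ν, hsub, ?_, ?_⟩
    · rwa [hνf]
    · funext j
      exact Fin.ext (congrFun hνf j)
  · intro ν hν _
    rfl

end Expansion

/-- The Vandermonde determinant of independent variables is not a zero divisor, so that identities
between tableau sums may be checked on alternants. -/
theorem vandermonde_X_ne_zero (N : ℕ) :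
    (Matrix.vandermonde fun i : Fin N => (MvPolynomial.X (i : ℕ) : MvPolynomial ℕ ℝ)).det ≠ 0 :=
  Matrix.det_vandermonde_ne_zero_iff.2 fun _ _ h => Fin.ext (MvPolynomial.X_injective h)

theorem eval_tabSum_X (N : ℕ) (a : ℤ → ℝ) (x : ℕ → ℝ) (f : ℕ → ℕ) (μ : YoungDiagram) :
    MvPolynomial.eval x (tabSum N (boxWeight (fun s => MvPolynomial.C (a s))
      (fun i => MvPolynomial.X (f i)) N) μ) = tabSum N (boxWeight a (fun i => x (f i)) N) μ := by
  rw [map_tabSum]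
  congr 1
  funext t i j
  simp [boxWeight]

/-- The expansion of factorial Schur polynomials in Schur polynomials. -/
theorem tabSum_boxWeight_eq_sum (a : ℤ → ℝ) {N : ℕ} (x : ℕ → ℝ) (μ : YoungDiagram)
    (hμ : μ.colLen 0 ≤ N) :
    tabSum N (boxWeight a x N) μ = ∑ ν ∈ subdiagrams μ,
      Matrix.det (Matrix.of fun i j => fallCoeff a (shifted N μ j) (shifted N ν i)) *
        tabSum N (boxWeight 0 x N) ν := by
  have h0 : (0 : ℤ → MvPolynomial ℕ ℝ) = fun s => MvPolynomial.C ((0 : ℤ → ℝ) s) := by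
    funext s
    simp
  have key : tabSum N (boxWeight (fun s => MvPolynomial.C (a s)) MvPolynomial.X N) μ =
      ∑ ν ∈ subdiagrams μ, MvPolynomial.C
        (Matrix.det (Matrix.of fun i j => fallCoeff a (shifted N μ j) (shifted N ν i))) *
          tabSum N (boxWeight 0 (MvPolynomial.X : ℕ → MvPolynomial ℕ ℝ) N) ν := by
    refine mul_left_cancel₀ (vandermonde_X_ne_zero N) ?_
    rw [← alternant_shifted _ N _ μ hμ, alternant_shifted_eq_sum _ _ μ hμ, mul_sum]
    refine sum_congr rfl fun ν hν => ?_
    rw [alternant_shifted 0 N _ ν ((colLen_zero_le (mem_subdiagrams.1 hν)).trans hμ),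
      RingHom.map_det]
    have hC : (Matrix.of fun i j => fallCoeff (fun s => (MvPolynomial.C (a s) : MvPolynomial ℕ ℝ))
        (shifted N μ j) (shifted N ν i)) = (MvPolynomial.C : ℝ →+* MvPolynomial ℕ ℝ).mapMatrix
          (Matrix.of fun i j => fallCoeff a (shifted N μ j) (shifted N ν i)) := by
      ext1 i j
      exact map_fallCoeff _ a _ _
    rw [hC]
    ring
  have h := congrArg (MvPolynomial.eval x) key
  rw [map_sum, h0] at h
  simp only [map_mul, MvPolynomial.eval_C] at h
  have h1 := fun (a : ℤ → ℝ) (ν : YoungDiagram) => eval_tabSum_X N a x id ν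
  simp only [id] at h1
  rw [← h1 a μ]
  refine h.trans (sum_congr rfl fun ν _ => ?_)
  rw [← h1 0 ν]

/-- Schur polynomials are symmetric under the reversal of the variables. -/
theorem tabSum_boxWeight_zero_reverse {N : ℕ} (x : ℕ → ℝ) (ν : YoungDiagram)
    (hν : ν.colLen 0 ≤ N) :
    tabSum N (boxWeight 0 (fun i => x (N - 1 - i)) N) ν = tabSum N (boxWeight 0 x N) ν := by
  have h0 : (0 : ℤ → MvPolynomial ℕ ℝ) = fun s => MvPolynomial.C ((0 : ℤ → ℝ) s) := by
    funext s
    simp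
  have hrev : ∀ i : Fin N, N - 1 - (i : ℕ) = (Fin.revPerm i : Fin N) := by
    intro i
    simp only [Fin.revPerm_apply, Fin.val_rev]
    omega
  have key : tabSum N (boxWeight 0 (fun i => (MvPolynomial.X (N - 1 - i) : MvPolynomial ℕ ℝ)) N) ν =
      tabSum N (boxWeight 0 (MvPolynomial.X : ℕ → MvPolynomial ℕ ℝ) N) ν := by
    have hsign : ((Equiv.Perm.sign (Fin.revPerm : Equiv.Perm (Fin N)) : ℤ) :
        MvPolynomial ℕ ℝ) ≠ 0 := by
      simp
    refine mul_left_cancel₀ (mul_ne_zero hsign (vandermonde_X_ne_zero N)) ?_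
    have h1 := alternant_shifted 0 N (MvPolynomial.X : ℕ → MvPolynomial ℕ ℝ) ν hν
    have h2 := alternant_shifted 0 N
      (fun i => (MvPolynomial.X (N - 1 - i) : MvPolynomial ℕ ℝ)) ν hν
    have h3 : (Matrix.vandermonde fun i : Fin N =>
        (MvPolynomial.X (N - 1 - (i : ℕ)) : MvPolynomial ℕ ℝ)) =
        (Matrix.vandermonde fun i : Fin N =>
          (MvPolynomial.X (i : ℕ) : MvPolynomial ℕ ℝ)).submatrix Fin.revPerm id := by
      ext1 i j
      simp only [hrev]
      rfl
    have h4 : alternant 0 (shifted N ν)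
        (fun i : Fin N => (MvPolynomial.X (N - 1 - (i : ℕ)) : MvPolynomial ℕ ℝ)) =
        (Equiv.Perm.sign (Fin.revPerm : Equiv.Perm (Fin N)) : ℤ) * alternant 0 (shifted N ν)
          (fun i : Fin N => (MvPolynomial.X (i : ℕ) : MvPolynomial ℕ ℝ)) := by
      simp only [hrev]
      exact Matrix.det_permute Fin.revPerm (Matrix.of fun i j : Fin N =>
        fallProd 0 (shifted N ν j) (MvPolynomial.X (i : ℕ) : MvPolynomial ℕ ℝ))
    rw [h3, Matrix.det_permute, h4, h1] at h2
    rw [mul_assoc] at h2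
    rw [mul_assoc, mul_assoc]
    exact h2.symm
  have h := congrArg (MvPolynomial.eval x) key
  rw [h0, eval_tabSum_X] at h
  exact h.trans (eval_tabSum_X N 0 x id ν)

/-! ### The coefficients for powers of `q` -/

theorem sum_cells {M : Type*} [AddCommMonoid M] {μ : YoungDiagram} {N : ℕ}
    (hμ : μ.colLen 0 ≤ N) (f : ℕ → ℕ → M) :
    ∑ c ∈ μ.cells, f c.1 c.2 = ∑ i ∈ range N, ∑ j ∈ range (μ.rowLen i), f i j := by
  have hrow : ∀ i, (⊥ : YoungDiagram).rowLen i = 0 := fun i => by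
    by_contra h
    exact YoungDiagram.notMem_bot _
      (YoungDiagram.mem_iff_lt_rowLen.2 (Nat.pos_of_ne_zero h))
  have h := sum_cells_sdiff μ ⊥ hμ f
  simpa only [YoungDiagram.cells_bot, sdiff_empty, hrow, ← range_eq_Ico] using h

theorem nStat_eq_sum (μ : YoungDiagram) : nStat μ = ∑ c ∈ μ.cells, c.1 := by
  rw [sum_cells le_rfl (fun i _ => i), nStat]
  simp [mul_comm]

theorem nStat_transpose_eq_sum (μ : YoungDiagram) :
    nStat μ.transpose = ∑ c ∈ μ.cells, c.2 := by
  rw [nStat_eq_sum]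
  refine sum_nbij' Prod.swap Prod.swap ?_ ?_ ?_ ?_ ?_
  · intro c hc
    exact YoungDiagram.mem_transpose.1 hc
  · intro c hc
    exact YoungDiagram.mem_transpose.2 hc
  · simp
  · simp
  · simp

/-- The finite `q`-Pochhammer symbol `(q; q)_m`. -/
def poch (q : ℝ) (m : ℕ) : ℝ :=
  ∏ i ∈ range m, (1 - q * q ^ i)

theorem poch_succ (q : ℝ) (m : ℕ) : poch q (m + 1) = poch q m * (1 - q * q ^ m) :=
  prod_range_succ _ _

theorem one_sub_mul_pow_pos {q : ℝ} (hq0 : 0 < q) (hq1 : q < 1) (m : ℕ) : 0 < 1 - q * q ^ m := by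
  rw [← pow_succ']
  exact sub_pos.2 (pow_lt_one₀ hq0.le hq1 (Nat.succ_ne_zero m))

theorem poch_ne_zero {q : ℝ} (hq0 : 0 < q) (hq1 : q < 1) (m : ℕ) : poch q m ≠ 0 :=
  (prod_pos fun i _ => one_sub_mul_pow_pos hq0 hq1 i).ne'

theorem invPoch_natCast (q : ℝ) (r : ℕ) : invPoch q (r : ℤ) = 1 / poch q r := rfl

theorem invPoch_of_neg (q : ℝ) {r : ℤ} (hr : r < 0) : invPoch q r = 0 := by
  obtain ⟨n, rfl⟩ := Int.eq_negSucc_of_lt_zero hr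
  rfl

/-- The parameters `a_s = q^{N - 1 - s}`, for which `N`-variable factorial Schur polynomials
truncate the series over tableaux. -/
def qParam (q : ℝ) (N : ℕ) (s : ℤ) : ℝ :=
  q ^ ((N : ℤ) - 1 - s)

/-- The product `∏_{s < m} q^{N - 1 - s}`. -/
def qParamProd (q : ℝ) (N m : ℕ) : ℝ :=
  ∏ s ∈ range m, qParam q N s

theorem qParam_ne_zero {q : ℝ} (hq0 : 0 < q) (N : ℕ) (s : ℤ) : qParam q N s ≠ 0 :=
  (zpow_pos hq0 _).ne'

theorem qParamProd_ne_zero {q : ℝ} (hq0 : 0 < q) (N m : ℕ) : qParamProd q N m ≠ 0 :=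
  prod_ne_zero_iff.2 fun _ _ => qParam_ne_zero hq0 _ _

theorem fallCoeff_succ_zero {R : Type*} [CommRing R] (a : ℤ → R) (m : ℕ) :
    fallCoeff a (m + 1) 0 = -(a m * fallCoeff a m 0) := by
  rw [fallCoeff, prod_range_succ, Polynomial.mul_coeff_zero, fallCoeff]
  simp
  ring

theorem fallCoeff_succ_succ {R : Type*} [CommRing R] (a : ℤ → R) (m k : ℕ) :
    fallCoeff a (m + 1) (k + 1) = fallCoeff a m k - a m * fallCoeff a m (k + 1) := by
  rw [fallCoeff, prod_range_succ, mul_sub, Polynomial.coeff_sub, Polynomial.coeff_mul_X,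
    Polynomial.coeff_mul_C, fallCoeff, fallCoeff]
  ring

/-- The `q`-binomial theorem: the coefficients of `(x - q^{N-1}) ⋯ (x - q^{N-m})`. -/
theorem fallCoeff_qParam {q : ℝ} (hq0 : 0 < q) (hq1 : q < 1) (N m k : ℕ) :
    fallCoeff (qParam q N) m k =
      ((-1) ^ m * qParamProd q N m * poch q m) *
        (((-1) ^ k / (qParamProd q N k * poch q k)) * invPoch q ((m : ℤ) - k)) := by
  have hP := poch_ne_zero hq0 hq1
  have hG := qParamProd_ne_zero hq0 N
  have hGs : ∀ m, qParamProd q N (m + 1) = qParamProd q N m * qParam q N m := fun m =>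
    prod_range_succ _ _
  have hdiag : ∀ m, ((-1) ^ m * qParamProd q N m * poch q m) *
      (((-1) ^ m / (qParamProd q N m * poch q m)) * invPoch q ((m : ℤ) - m)) = 1 := by
    intro m
    have h1 : invPoch q ((m : ℤ) - m) = 1 := by
      rw [sub_self]
      simp [invPoch]
    have h2 : ((-1 : ℝ) ^ m) * (-1) ^ m = 1 := by
      rw [← mul_pow]
      simp
    rw [h1]
    have := hP m
    have := hG m
    field_simp
    linear_combination h2
  induction m generalizing k with
  | zero =>
    rcases k.eq_zero_or_pos with rfl | hk
    · rw [hdiag, fallCoeff]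
      simp
    · rw [fallCoeff_eq_zero _ hk, invPoch_of_neg q (by omega)]
      simp
  | succ m ih =>
    rcases k with _ | k
    · rw [fallCoeff_succ_zero, ih, hGs, Nat.cast_zero, sub_zero, sub_zero, invPoch_natCast,
        invPoch_natCast]
      have := hP m
      have := hP (m + 1)
      have := hG 0
      have := hP 0
      field_simp
      ring
    · rcases lt_trichotomy m k with h | rfl | h
      · rw [fallCoeff_eq_zero _ (by omega), invPoch_of_neg q (by omega)]
        simp
      · rw [hdiag, fallCoeff_succ_succ, ih, hdiag, fallCoeff_eq_zero _ (Nat.lt_succ_self m)]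
        simp
      · obtain ⟨r, rfl⟩ := Nat.exists_eq_add_of_lt h
        have e1 : ((k + r + 1 + 1 : ℕ) : ℤ) - (k + 1 : ℕ) = (r + 1 : ℕ) := by push_cast; ring
        have e2 : ((k + r + 1 : ℕ) : ℤ) - (k + 1 : ℕ) = (r : ℕ) := by push_cast; ring
        have e3 : ((k + r + 1 : ℕ) : ℤ) - (k : ℕ) = (r + 1 : ℕ) := by push_cast; ring
        -- After cancellation the recursion reads
        -- `a_m (1 - q^{m+1}) = a_k (1 - q^{k+1}) + a_m (1 - q^{r+1})`, where `m = k + r + 1`.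
        have ha : qParam q N k = qParam q N (k + r + 1 : ℕ) * q ^ (r + 1) := by
          rw [qParam, qParam, ← zpow_natCast, ← zpow_add₀ hq0.ne']
          congr 1
          push_cast
          ring
        rw [fallCoeff_succ_succ, ih, ih, e1, e2, e3, invPoch_natCast, invPoch_natCast,
          hGs (k + r + 1), hGs k, poch_succ q (k + r + 1), poch_succ q k, poch_succ q r, ha]
        have h1 := (one_sub_mul_pow_pos hq0 hq1 k).ne'
        have h2 := (one_sub_mul_pow_pos hq0 hq1 r).ne'
        have h3 := hP k
        have h4 := hP r
        have h5 := hG k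
        have h6 : q ^ (r + 1) ≠ 0 := pow_ne_zero _ hq0.ne'
        have h7 := qParam_ne_zero hq0 N (k + r + 1 : ℕ)
        field_simp
        ring

/-- The determinant `det[1 / (q; q)_{μ_i - ν_k - i + k}]` of size `N`. -/
def sigmaDet (q : ℝ) (μ ν : YoungDiagram) (N : ℕ) : ℝ :=
  Matrix.det (Matrix.of fun i k : Fin N =>
    invPoch q ((μ.rowLen i : ℤ) - (ν.rowLen k : ℤ) - ((i : ℕ) : ℤ) + ((k : ℕ) : ℤ)))

/-- Beyond the length of `μ`, the determinant does not depend on its size: the extra rows are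
unitriangular. -/
theorem sigmaDet_eq (q : ℝ) {μ ν : YoungDiagram} (h : ν ≤ μ) {N : ℕ} (hN : μ.colLen 0 ≤ N) :
    sigmaDet q μ ν N = sigmaDet q μ ν (μ.colLen 0) := by
  induction N, hN using Nat.le_induction with
  | base => rfl
  | succ N hN ih =>
    rw [← ih, sigmaDet, Matrix.det_succ_row _ (Fin.last N), Fin.sum_univ_castSucc, sum_eq_zero,
      zero_add]
    · have h1 : invPoch q (((μ.rowLen N : ℤ) - ν.rowLen N - (N : ℤ) + N)) = 1 := by
        rw [rowLen_eq_zero hN le_rfl, rowLen_eq_zero ((colLen_zero_le h).trans hN) le_rfl]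
        simp [invPoch]
      simp only [Matrix.of_apply, Fin.val_last, h1, Fin.succAbove_last, sigmaDet]
      rw [Even.neg_one_pow ⟨N, rfl⟩, one_mul, one_mul]
      rfl
    · intro k _
      have hk := k.2
      simp only [Matrix.of_apply, Fin.val_last, Fin.val_castSucc]
      rw [invPoch_of_neg, mul_zero, zero_mul]
      rw [rowLen_eq_zero hN le_rfl]
      omega

theorem prod_shifted {M : Type*} [CommMonoid M] (N : ℕ) (μ : YoungDiagram) (f : ℕ → M) :
    ∏ j, f (shifted N μ j) = ∏ i ∈ range N, f (N - 1 - i + μ.rowLen i) := by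
  rw [← prod_range_reflect, ← Fin.prod_univ_eq_prod_range
    (fun j => f (N - 1 - (N - 1 - j) + μ.rowLen (N - 1 - j)))]
  refine prod_congr rfl fun j _ => ?_
  have := j.2
  rw [shifted, add_comm]
  congr 2
  omega

/-- The sign and the powers of `q` from the `q`-binomial theorem, up to a factor independent
of `μ`. -/
theorem prod_sign_qParamProd {q : ℝ} (hq0 : 0 < q) {N : ℕ} {μ : YoungDiagram}
    (hμ : μ.colLen 0 ≤ N) :
    ∏ j, ((-1) ^ shifted N μ j * qParamProd q N (shifted N μ j)) =
      (∏ i ∈ range N, ((-1) ^ (N - 1 - i) * qParamProd q N (N - 1 - i))) *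
        ((-1) ^ (μ.card : ℤ) * q ^ ((nStat μ : ℤ) - nStat μ.transpose)) := by
  rw [prod_shifted N μ fun m => (-1) ^ m * qParamProd q N m]
  have hstat : (nStat μ : ℤ) - nStat μ.transpose =
      ∑ i ∈ range N, ∑ j ∈ range (μ.rowLen i), ((i : ℤ) - j) := by
    rw [← sum_cells hμ fun i j => (i : ℤ) - j, nStat_eq_sum, nStat_transpose_eq_sum]
    push_cast
    rw [sum_sub_distrib]
  have hcard : μ.card = ∑ i ∈ range N, μ.rowLen i := by
    have := sum_cells hμ fun _ _ => 1
    simpa using this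
  have hz : ∀ (s : Finset ℕ) (e : ℕ → ℤ), q ^ (∑ i ∈ s, e i) = ∏ i ∈ s, q ^ e i := by
    intro s e
    induction s using Finset.induction_on with
    | empty => simp
    | insert a s ha ih => rw [sum_insert ha, prod_insert ha, zpow_add₀ hq0.ne', ih]
  rw [hstat, hz, zpow_natCast, hcard, ← prod_pow_eq_pow_sum, ← prod_mul_distrib,
    ← prod_mul_distrib]
  refine prod_congr rfl fun i hi => ?_
  have hi := mem_range.1 hi
  have h1 : qParamProd q N (N - 1 - i + μ.rowLen i) =
      qParamProd q N (N - 1 - i) * q ^ (∑ j ∈ range (μ.rowLen i), ((i : ℤ) - j)) := by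
    rw [qParamProd, prod_range_add, hz]
    congr 1
    refine prod_congr rfl fun j _ => ?_
    rw [qParam]
    congr 1
    omega
  rw [h1, pow_add]
  ring

/-- The correction factor between the coefficients in `N` variables and `σ(μ, ν; q)`. -/
def pochRatio (q : ℝ) (μ ν : YoungDiagram) (N : ℕ) : ℝ :=
  (∏ j, poch q (shifted N μ j)) / ∏ j, poch q (shifted N ν j)

/-- Reversing the order of the rows and columns and transposing turns the determinant of the
expansion into that of `σ`. -/
theorem det_invPoch_shifted (q : ℝ) (μ ν : YoungDiagram) (N : ℕ) :
    Matrix.det (Matrix.of fun i j : Fin N =>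
      invPoch q ((shifted N μ j : ℤ) - (shifted N ν i : ℤ))) = sigmaDet q μ ν N := by
  rw [sigmaDet, ← Matrix.det_submatrix_equiv_self Fin.revPerm, ← Matrix.det_transpose]
  congr 1
  ext i k
  have hi := i.2
  have hk := k.2
  simp only [Matrix.transpose_apply, Matrix.submatrix_apply, Matrix.of_apply, shifted,
    Fin.revPerm_apply, Fin.val_rev]
  have h1 : N - 1 - (N - (i + 1)) = (i : ℕ) := by omega
  have h2 : N - 1 - (N - (k + 1)) = (k : ℕ) := by omega
  rw [h1, h2]
  congr 1
  omega

/-- The coefficients of the expansion in `N` variables, compared with `σ(μ, ν; q)`. -/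
theorem det_fallCoeff_qParam {q : ℝ} (hq0 : 0 < q) (hq1 : q < 1) {μ ν : YoungDiagram}
    (h : ν ≤ μ) {N : ℕ} (hN : μ.colLen 0 ≤ N) :
    Matrix.det (Matrix.of fun i j =>
      fallCoeff (qParam q N) (shifted N μ j) (shifted N ν i)) =
      pochRatio q μ ν N * sigma q μ ν := by
  have hν := (colLen_zero_le h).trans hN
  have h1 : (Matrix.of fun i j => fallCoeff (qParam q N) (shifted N μ j) (shifted N ν i)) =
      Matrix.of fun i j => ((-1) ^ shifted N μ j * qParamProd q N (shifted N μ j) *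
        poch q (shifted N μ j)) * (Matrix.of fun i j => ((-1) ^ shifted N ν i /
          (qParamProd q N (shifted N ν i) * poch q (shifted N ν i))) * (Matrix.of fun i j =>
            invPoch q ((shifted N μ j : ℤ) - (shifted N ν i : ℤ))) i j) i j := by
    ext i j
    exact fallCoeff_qParam hq0 hq1 N _ _
  have hsign : ∀ m : ℕ, ((-1 : ℝ) ^ m)⁻¹ = (-1) ^ m := fun m => by
    rw [← inv_pow, inv_neg_one]
  have hinv : ∏ i, ((-1) ^ shifted N ν i /
      (qParamProd q N (shifted N ν i) * poch q (shifted N ν i))) =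
      (∏ i, ((-1) ^ shifted N ν i * qParamProd q N (shifted N ν i)))⁻¹ *
        (∏ i, poch q (shifted N ν i))⁻¹ := by
    rw [← prod_inv_distrib, ← prod_inv_distrib, ← prod_mul_distrib]
    refine prod_congr rfl fun i _ => ?_
    rw [mul_inv, hsign, div_eq_mul_inv, mul_inv, mul_assoc]
  have hc : ∏ i ∈ range N, ((-1) ^ (N - 1 - i) * qParamProd q N (N - 1 - i)) ≠ 0 :=
    prod_ne_zero_iff.2 fun i _ => mul_ne_zero (pow_ne_zero _ (by norm_num))
      (qParamProd_ne_zero hq0 _ _)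
  rw [h1, Matrix.det_mul_row, Matrix.det_mul_column, det_invPoch_shifted, sigmaDet_eq q h hN,
    hinv, prod_mul_distrib, prod_sign_qParamProd hq0 hN, prod_sign_qParamProd hq0 hν, pochRatio]
  have hsig : sigma q μ ν = (-1) ^ ((μ.card : ℤ) - (ν.card : ℤ)) *
      q ^ ((nStat μ : ℤ) - nStat μ.transpose - nStat ν + nStat ν.transpose) *
        sigmaDet q μ ν (μ.colLen 0) := rfl
  have he : (nStat μ : ℤ) - nStat μ.transpose - nStat ν + nStat ν.transpose =
      (nStat μ - nStat μ.transpose : ℤ) - (nStat ν - nStat ν.transpose : ℤ) := by ring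
  rw [hsig, he, zpow_sub₀ (by norm_num : (-1 : ℝ) ≠ 0), zpow_sub₀ hq0.ne' (_ - _) (_ - _)]
  have h2 : ((-1 : ℝ) ^ (ν.card : ℤ)) ≠ 0 := zpow_ne_zero _ (by norm_num)
  have h3 : q ^ ((nStat ν : ℤ) - nStat ν.transpose) ≠ 0 := zpow_ne_zero _ hq0.ne'
  have h4 : ∏ i, poch q (shifted N ν i) ≠ 0 :=
    prod_ne_zero_iff.2 fun i _ => poch_ne_zero hq0 hq1 _
  generalize ∏ i ∈ range N, ((-1) ^ (N - 1 - i) * qParamProd q N (N - 1 - i)) = u at *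
  generalize ∏ i, poch q (shifted N ν i) = v at *
  generalize q ^ ((nStat ν : ℤ) - nStat ν.transpose) = w at *
  field_simp

theorem tendsto_poch_ratio {q : ℝ} (hq0 : 0 < q) (hq1 : q < 1) (a : ℕ) :
    Tendsto (fun n => poch q (n + a) / poch q n) atTop (𝓝 1) := by
  have h1 : ∀ n, poch q (n + a) / poch q n = ∏ s ∈ range a, (1 - q * q ^ (n + s)) := by
    intro n
    rw [poch, prod_range_add]
    exact mul_div_cancel_left₀ _ (poch_ne_zero hq0 hq1 n)
  simp only [h1]
  have h2 : Tendsto (fun n => ∏ s ∈ range a, (1 - q * q ^ (n + s))) atTop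
      (𝓝 (∏ s ∈ range a, (1 - q * 0))) := by
    refine tendsto_finsetProd _ fun s _ => ?_
    refine Tendsto.const_sub _ (Tendsto.const_mul _ ?_)
    exact (tendsto_pow_atTop_nhds_zero_of_lt_one hq0.le hq1).comp (tendsto_add_atTop_nat s)
  simpa using h2

theorem tendsto_pochRatio {q : ℝ} (hq0 : 0 < q) (hq1 : q < 1) {μ ν : YoungDiagram} (h : ν ≤ μ) :
    Tendsto (pochRatio q μ ν) atTop (𝓝 1) := by
  have hP := poch_ne_zero hq0 hq1
  have key : ∀ N, μ.colLen 0 ≤ N → ∏ i ∈ range (μ.colLen 0),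
      ((poch q (N - 1 - i + μ.rowLen i) / poch q (N - 1 - i)) /
        (poch q (N - 1 - i + ν.rowLen i) / poch q (N - 1 - i))) = pochRatio q μ ν N := by
    intro N hN
    rw [pochRatio, prod_shifted N μ, prod_shifted N ν, ← prod_div_distrib]
    have hsub : range (μ.colLen 0) ⊆ range N := range_subset_range.2 hN
    rw [← prod_subset hsub]
    · exact prod_congr rfl fun i _ => div_div_div_cancel_right₀ (hP _) _ _
    · intro i _ hi
      have hi : μ.colLen 0 ≤ i := not_lt.1 fun h' => hi (mem_range.2 h')
      rw [rowLen_eq_zero le_rfl hi, rowLen_eq_zero (colLen_zero_le h) hi]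
      exact div_self (hP _)
  have hlim : Tendsto (fun N => ∏ i ∈ range (μ.colLen 0),
      ((poch q (N - 1 - i + μ.rowLen i) / poch q (N - 1 - i)) /
        (poch q (N - 1 - i + ν.rowLen i) / poch q (N - 1 - i)))) atTop
      (𝓝 (∏ i ∈ range (μ.colLen 0), (1 / 1))) := by
    refine tendsto_finsetProd _ fun i _ => ?_
    have hs : Tendsto (fun N => N - 1 - i) atTop atTop :=
      (tendsto_sub_atTop_nat i).comp (tendsto_sub_atTop_nat 1)
    exact ((tendsto_poch_ratio hq0 hq1 _).comp hs).div ((tendsto_poch_ratio hq0 hq1 _).comp hs)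
      one_ne_zero
  simp only [div_one, prod_const_one] at hlim
  exact hlim.congr' ((eventually_ge_atTop _).mono fun N hN => key N hN)

/-! ### Absolute convergence and the passage to infinitely many variables -/

/-- If `∑ g t` converges, so does its `ι`-fold product, multiplied out. -/
theorem summable_pi_prod {ι : Type*} [Fintype ι] {g : ℕ → ℝ} (hg0 : ∀ t, 0 ≤ g t)
    (hg : Summable g) : Summable fun f : ι → ℕ => ∏ c, g (f c) := by
  classical
  refine summable_of_sum_le (c := ∏ _c : ι, ∑' t, g t) (fun f => prod_nonneg fun c _ => hg0 _)
    fun s => ?_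
  have hsub : s ⊆ Fintype.piFinset fun c => s.image fun f => f c := fun f hf =>
    Fintype.mem_piFinset.2 fun c => mem_image_of_mem _ hf
  calc ∑ f ∈ s, ∏ c, g (f c)
      ≤ ∑ f ∈ Fintype.piFinset fun c => s.image fun f => f c, ∏ c, g (f c) :=
        sum_le_sum_of_subset_of_nonneg hsub fun f _ _ => prod_nonneg fun c _ => hg0 _
    _ = ∏ c, ∑ t ∈ s.image fun f => f c, g t := (prod_univ_sum _ _).symm
    _ ≤ ∏ _c : ι, ∑' t, g t := prod_le_prod (fun c _ => sum_nonneg fun t _ => hg0 t)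
        fun c _ => hg.sum_le_tsum _ fun t _ => hg0 t

/-- Fillings of finitely many boxes, weighted by a product of a summable function of the entries. -/
theorem summable_prod_cells {α : Type*} {s : Finset (ℕ × ℕ)} {entry : α → ℕ → ℕ → ℕ}
    (hinj : Function.Injective fun (T : α) (c : s) => entry T c.1.1 c.1.2) {g : ℕ → ℝ}
    (hg0 : ∀ t, 0 ≤ g t) (hg : Summable g) :
    Summable fun T : α => ∏ c ∈ s, g (entry T c.1 c.2) := by
  refine ((summable_pi_prod hg0 hg).comp_injective hinj).congr fun T => ?_
  exact prod_coe_sort s fun c => g (entry T c.1 c.2)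

theorem summable_abs_lp (X : lp (fun _ : ℕ => ℝ) 1) : Summable fun i => |X i| := by
  have h := (lp.memℓp X).summable (by simp)
  simpa using h

section ReverseTableaux

variable {μ : YoungDiagram}

/-- A common summable majorant, as a function of the entry, for the two quantities attached to a
box. -/
def majorant (q : ℝ) (X : lp (fun _ : ℕ => ℝ) 1) (μ : YoungDiagram) (t : ℕ) : ℝ :=
  |X t| + q ^ (-(μ.rowLen 0 : ℤ)) * q ^ t

theorem majorant_nonneg {q : ℝ} (hq0 : 0 < q) (X : lp (fun _ : ℕ => ℝ) 1) (t : ℕ) :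
    0 ≤ majorant q X μ t := by
  unfold majorant
  positivity

theorem summable_majorant {q : ℝ} (hq0 : 0 < q) (hq1 : q < 1) (X : lp (fun _ : ℕ => ℝ) 1) :
    Summable (majorant q X μ) :=
  (summable_abs_lp X).add ((summable_geometric_of_lt_one hq0.le hq1).mul_left _)

theorem abs_boxVar_le {q : ℝ} (hq0 : 0 < q) (X : lp (fun _ : ℕ => ℝ) 1) (T : ReverseTableau μ)
    (c : ℕ × ℕ) : |boxVar X T c| ≤ majorant q X μ (T.entry c.1 c.2) := by
  unfold boxVar majorant
  have : 0 ≤ q ^ (-(μ.rowLen 0 : ℤ)) * q ^ T.entry c.1 c.2 := by positivity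
  linarith

theorem abs_boxShift_le {q : ℝ} (hq0 : 0 < q) (hq1 : q < 1) (X : lp (fun _ : ℕ => ℝ) 1)
    (T : ReverseTableau μ) {c : ℕ × ℕ} (hc : c ∈ μ) :
    |-boxShift q T c| ≤ majorant q X μ (T.entry c.1 c.2) := by
  have h1 : c.2 < μ.rowLen 0 :=
    (YoungDiagram.mem_iff_lt_rowLen.1 hc).trans_le (μ.rowLen_anti _ _ (Nat.zero_le _))
  unfold boxShift majorant
  rw [abs_neg, abs_of_pos (zpow_pos hq0 _), ← zpow_natCast q (T.entry _ _), ← zpow_add₀ hq0.ne']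
  refine (zpow_le_zpow_right_of_le_one₀ hq0 hq1.le ?_).trans (le_add_of_nonneg_left (abs_nonneg _))
  omega

theorem abs_expandedTerm_le {q : ℝ} (hq0 : 0 < q) (hq1 : q < 1) (X : lp (fun _ : ℕ => ℝ) 1)
    (T : ReverseTableau μ) {A : Finset (ℕ × ℕ)} (hA : A ⊆ μ.cells) :
    |expandedTerm q X T A| ≤ ∏ c ∈ μ.cells, majorant q X μ (T.entry c.1 c.2) := by
  rw [expandedTerm, abs_mul, abs_prod, abs_prod, ← prod_sdiff hA, mul_comm]
  refine mul_le_mul (prod_le_prod (fun _ _ => abs_nonneg _) fun c hc => ?_)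
    (prod_le_prod (fun _ _ => abs_nonneg _) fun c _ => abs_boxVar_le hq0 X T c)
    (prod_nonneg fun _ _ => abs_nonneg _)
    (prod_nonneg fun _ _ => majorant_nonneg hq0 X _)
  exact abs_boxShift_le hq0 hq1 X T (Finset.mem_sdiff.1 hc).1

theorem summable_abs_expandedTerm {q : ℝ} (hq0 : 0 < q) (hq1 : q < 1) (X : lp (fun _ : ℕ => ℝ) 1)
    (μ : YoungDiagram) :
    Summable fun p : ReverseTableau μ × {A : Finset (ℕ × ℕ) // A ⊆ μ.cells} =>
      |expandedTerm q X p.1 p.2.1| := by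
  let _ : Fintype {A : Finset (ℕ × ℕ) // A ⊆ μ.cells} :=
    Fintype.subtype μ.cells.powerset fun _ => mem_powerset
  have hG : Summable fun T : ReverseTableau μ =>
      ∏ c ∈ μ.cells, majorant q X μ (T.entry c.1 c.2) :=
    summable_prod_cells ReverseTableau.restrict_injective (majorant_nonneg hq0 X)
      (summable_majorant hq0 hq1 X)
  have h1 : Summable fun _ : {A : Finset (ℕ × ℕ) // A ⊆ μ.cells} => (1 : ℝ) :=
    (hasSum_fintype _).summable
  refine Summable.of_nonneg_of_le (fun _ => abs_nonneg _) (fun p => ?_)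
    (hG.mul_of_nonneg h1 (fun T => prod_nonneg fun _ _ => majorant_nonneg hq0 X _)
      fun _ => zero_le_one)
  rw [mul_one]
  exact abs_expandedTerm_le hq0 hq1 X p.1 p.2.2

/-- Expanding the product over the boxes of a fixed tableau. -/
theorem hasSum_expandedTerm (q : ℝ) (X : lp (fun _ : ℕ => ℝ) 1) (T : ReverseTableau μ) :
    HasSum (fun A : {A : Finset (ℕ × ℕ) // A ⊆ μ.cells} => expandedTerm q X T A.1)
      (term q X T) := by
  let _ : Fintype {A : Finset (ℕ × ℕ) // A ⊆ μ.cells} :=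
    Fintype.subtype μ.cells.powerset fun _ => mem_powerset
  have h : term q X T = ∑ A : {A : Finset (ℕ × ℕ) // A ⊆ μ.cells}, expandedTerm q X T A.1 := by
    rw [← sum_subtype μ.cells.powerset (fun _ => mem_powerset) fun A => expandedTerm q X T A, term]
    simp only [sub_eq_add_neg]
    exact prod_add _ _ _
  rw [h]
  exact hasSum_fintype _

/-- The tableaux with bounded entries exhaust all reverse tableaux. -/
theorem tendsto_bounded (μ : YoungDiagram) :
    Tendsto (fun N => ReverseTableau.bounded N μ) atTop atTop := by
  refine tendsto_atTop_finset_of_monotone (fun N N' h T hT => ?_) fun T => ?_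
  · rw [ReverseTableau.mem_bounded] at hT ⊢
    exact fun c hc => (hT c hc).trans_le h
  · refine ⟨T.entry 0 0 + 1, ReverseTableau.mem_bounded.2 fun c hc => Nat.lt_succ_of_le ?_⟩
    exact T.entry_anti (Nat.zero_le _) (Nat.zero_le _) hc

/-- The partial sums of the series over tableaux are factorial Schur polynomials: with
`a_s = q^{N - 1 - s}` the weight of the entry `t` in the box `(i, j)` is `x_t - q^{t + i - j}`. -/
theorem sum_term_bounded (q : ℝ) (X : lp (fun _ : ℕ => ℝ) 1) (N : ℕ) (μ : YoungDiagram) :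
    ∑ T ∈ ReverseTableau.bounded N μ, term q X T = tabSum N (boxWeight (qParam q N) X N) μ := by
  refine sum_congr rfl fun T _ => prod_congr rfl fun c _ => ?_
  rw [boxVar, boxShift, boxWeight, qParam]
  congr 2
  ring

end ReverseTableaux

section Schur

variable {ν : YoungDiagram}

theorem ssyt_restrict_injective :
    Function.Injective fun (T : SemistandardYoungTableau ν) (c : ν.cells) => T c.1.1 c.1.2 := by
  intro T T' h
  ext i j
  by_cases hc : (i, j) ∈ ν
  · exact congrFun h ⟨(i, j), hc⟩
  · rw [T.zeros hc, T'.zeros hc]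

theorem ssyt_finite_bounded (N : ℕ) (ν : YoungDiagram) :
    {T : SemistandardYoungTableau ν | ∀ c ∈ ν.cells, T c.1 c.2 < N}.Finite := by
  have h : {f : ν.cells → ℕ | ∀ c, f c ∈ Set.Iio N}.Finite :=
    Set.Finite.pi' fun _ => Set.finite_Iio N
  refine (h.preimage (ssyt_restrict_injective (ν := ν)).injOn).subset ?_
  exact fun T hT c => hT c.1 c.2

/-- The semistandard tableaux of shape `ν` with entries `0, …, N - 1`. -/
def ssytBounded (N : ℕ) (ν : YoungDiagram) : Finset (SemistandardYoungTableau ν) :=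
  (ssyt_finite_bounded N ν).toFinset

theorem mem_ssytBounded {N : ℕ} {T : SemistandardYoungTableau ν} :
    T ∈ ssytBounded N ν ↔ ∀ c ∈ ν.cells, T c.1 c.2 < N := by
  simp [ssytBounded]

theorem tendsto_ssytBounded (ν : YoungDiagram) :
    Tendsto (fun N => ssytBounded N ν) atTop atTop := by
  refine tendsto_atTop_finset_of_monotone (fun N N' h T hT => ?_) fun T => ?_
  · rw [mem_ssytBounded] at hT ⊢
    exact fun c hc => (hT c hc).trans_le h
  · refine ⟨ν.cells.sup (fun c => T c.1 c.2) + 1,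
      mem_ssytBounded.2 fun c hc => Nat.lt_succ_of_le ?_⟩
    exact le_sup (f := fun c : ℕ × ℕ => T c.1 c.2) hc

/-- Complementing the entries of a semistandard tableau gives a reverse tableau. -/
def ssytComplement (N : ℕ) (T : SemistandardYoungTableau ν) (hT : T ∈ ssytBounded N ν) :
    ReverseTableau ν where
  entry i j := if (i, j) ∈ ν then N - 1 - T i j else 0
  row_weak {i j₁ j₂} hj hc := by
    rw [if_pos hc, if_pos (ν.up_left_mem le_rfl hj.le hc)]
    have := T.row_weak hj hc
    omega
  col_strict {i₁ i₂ j} hi hc := by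
    rw [if_pos hc, if_pos (ν.up_left_mem hi.le le_rfl hc)]
    have h1 := T.col_strict hi hc
    have h2 := mem_ssytBounded.1 hT (i₂, j) hc
    simp only at h2
    omega
  zeros hc := if_neg hc

/-- Complementing the entries of a reverse tableau gives a semistandard tableau. -/
def reverseComplement (N : ℕ) (T : ReverseTableau ν) (hT : T ∈ ReverseTableau.bounded N ν) :
    SemistandardYoungTableau ν where
  entry i j := if (i, j) ∈ ν then N - 1 - T.entry i j else 0
  row_weak' {i j₁ j₂} hj hc := by
    rw [if_pos hc, if_pos (ν.up_left_mem le_rfl hj.le hc)]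
    have := T.row_weak hj hc
    omega
  col_strict' {i₁ i₂ j} hi hc := by
    rw [if_pos hc, if_pos (ν.up_left_mem hi.le le_rfl hc)]
    have h1 := T.col_strict hi hc
    have h2 := ReverseTableau.mem_bounded.1 hT (i₁, j) (ν.up_left_mem hi.le le_rfl hc)
    simp only at h2
    omega
  zeros' hc := if_neg hc

theorem ssytComplement_apply {N : ℕ} {T : SemistandardYoungTableau ν} {hT : T ∈ ssytBounded N ν}
    {i j : ℕ} (hc : (i, j) ∈ ν) : (ssytComplement N T hT).entry i j = N - 1 - T i j :=
  if_pos hc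

theorem reverseComplement_apply {N : ℕ} {T : ReverseTableau ν}
    {hT : T ∈ ReverseTableau.bounded N ν} {i j : ℕ} (hc : (i, j) ∈ ν) :
    reverseComplement N T hT i j = N - 1 - T.entry i j :=
  if_pos hc

/-- Schur polynomials as sums over semistandard tableaux or over reverse tableaux. -/
theorem sum_ssytBounded {N : ℕ} (x : ℕ → ℝ) (hν : ν.colLen 0 ≤ N) :
    ∑ T ∈ ssytBounded N ν, ∏ c ∈ ν.cells, x (T c.1 c.2) = tabSum N (boxWeight 0 x N) ν := by
  rw [← tabSum_boxWeight_zero_reverse x ν hν]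
  refine sum_bij' (fun T hT => ssytComplement N T hT) (fun T hT => reverseComplement N T hT)
    ?_ ?_ ?_ ?_ ?_
  · intro T hT
    refine ReverseTableau.mem_bounded.2 fun c hc => ?_
    rw [ssytComplement_apply (i := c.1) (j := c.2) hc]
    have := mem_ssytBounded.1 hT c hc
    omega
  · intro T hT
    refine mem_ssytBounded.2 fun c hc => ?_
    rw [reverseComplement_apply (i := c.1) (j := c.2) hc]
    have := ReverseTableau.mem_bounded.1 hT c hc
    omega
  · intro T hT
    ext i j
    by_cases hc : (i, j) ∈ ν
    · have := mem_ssytBounded.1 hT (i, j) hc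
      simp only at this
      rw [reverseComplement_apply hc, ssytComplement_apply hc]
      omega
    · rw [SemistandardYoungTableau.zeros _ hc, T.zeros hc]
  · intro T hT
    ext i j
    by_cases hc : (i, j) ∈ ν
    · have := ReverseTableau.mem_bounded.1 hT (i, j) hc
      simp only at this
      rw [ssytComplement_apply hc, reverseComplement_apply hc]
      omega
    · rw [ReverseTableau.zeros _ hc, T.zeros hc]
  · intro T hT
    refine prod_congr rfl fun c hc => ?_
    have := mem_ssytBounded.1 hT c hc
    rw [boxWeight, ssytComplement_apply (i := c.1) (j := c.2) hc, Pi.zero_apply, sub_zero]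
    congr 1
    omega

theorem prod_weight (x : ℕ → ℝ) (T : SemistandardYoungTableau ν) :
    ((weight T).prod fun i k => x i ^ k) = ∏ c ∈ ν.cells, x (T c.1 c.2) := by
  rw [weight, ← Finsupp.prod_finsetSum_index (fun i => pow_zero _) fun i => pow_add _]
  simp

theorem summable_ssyt (X : lp (fun _ : ℕ => ℝ) 1) (ν : YoungDiagram) :
    Summable fun T : SemistandardYoungTableau ν => ∏ c ∈ ν.cells, X (T c.1 c.2) := by
  refine Summable.of_abs ?_
  simp only [abs_prod]
  exact summable_prod_cells (entry := fun (T : SemistandardYoungTableau ν) i j => T i j)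
    (g := fun t => |X t|) ssyt_restrict_injective (fun _ => abs_nonneg _) (summable_abs_lp X)

/-- The value of a Schur function on `ℓ¹` is the sum over semistandard tableaux; the series over
monomials collects the tableaux of equal weight. -/
theorem hasSum_schur (X : lp (fun _ : ℕ => ℝ) 1) (ν : YoungDiagram) :
    HasSum (fun m : ℕ →₀ ℕ => MvPowerSeries.coeff m (schur ν) * m.prod fun i k => X i ^ k)
      (∑' T : SemistandardYoungTableau ν, ∏ c ∈ ν.cells, X (T c.1 c.2)) := by
  have h := (Equiv.sigmaFiberEquiv (weight (ν := ν))).hasSum_iff.2 (summable_ssyt X ν).hasSum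
  refine h.sigma fun m => ?_
  have hs := (h.summable.sigma_factor m).hasSum
  have hc : ∀ T : {T : SemistandardYoungTableau ν // weight T = m},
      ((fun T : SemistandardYoungTableau ν => ∏ c ∈ ν.cells, X (T c.1 c.2)) ∘
        Equiv.sigmaFiberEquiv (weight (ν := ν))) ⟨m, T⟩ = m.prod fun i k => X i ^ k := by
    rintro ⟨T, rfl⟩
    exact (prod_weight X T).symm
  simp only [hc] at hs ⊢
  rw [tsum_const, nsmul_eq_mul] at hs
  exact hs

/-- The Schur polynomials converge to the sum over all semistandard tableaux. -/
theorem tendsto_schur (X : lp (fun _ : ℕ => ℝ) 1) (ν : YoungDiagram) :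
    Tendsto (fun N => tabSum N (boxWeight 0 X N) ν) atTop
      (𝓝 (∑' T : SemistandardYoungTableau ν, ∏ c ∈ ν.cells, X (T c.1 c.2))) := by
  refine ((summable_ssyt X ν).hasSum.comp (tendsto_ssytBounded ν)).congr' ?_
  filter_upwards [eventually_ge_atTop (ν.colLen 0)] with N hN
  exact sum_ssytBounded X hN

end Schur

theorem eval_interpolation (q : ℝ) (μ : YoungDiagram) (X : lp (fun _ : ℕ => ℝ) 1) :
    eval (interpolation q μ) X = ∑ ν ∈ subdiagrams μ, sigma q μ ν *
      ∑' T : SemistandardYoungTableau ν, ∏ c ∈ ν.cells, X (T c.1 c.2) := by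
  have h := hasSum_sum fun ν (_ : ν ∈ subdiagrams μ) => (hasSum_schur X ν).mul_left (sigma q μ ν)
  refine Eq.trans (tsum_congr fun m => ?_) h.tsum_eq
  rw [interpolation, map_sum, sum_mul]
  refine sum_congr rfl fun ν _ => ?_
  rw [MvPowerSeries.coeff_smul, mul_assoc]

/-- The expansions in `N` variables converge term by term to the interpolation function. -/
theorem tendsto_tabSum_interpolation {q : ℝ} (hq0 : 0 < q) (hq1 : q < 1) (μ : YoungDiagram)
    (X : lp (fun _ : ℕ => ℝ) 1) :
    Tendsto (fun N => tabSum N (boxWeight (qParam q N) X N) μ) atTop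
      (𝓝 (eval (interpolation q μ) X)) := by
  rw [eval_interpolation]
  have h : Tendsto (fun N => ∑ ν ∈ subdiagrams μ, pochRatio q μ ν N * sigma q μ ν *
      tabSum N (boxWeight 0 X N) ν) atTop (𝓝 (∑ ν ∈ subdiagrams μ, 1 * sigma q μ ν *
        ∑' T : SemistandardYoungTableau ν, ∏ c ∈ ν.cells, X (T c.1 c.2))) :=
    tendsto_finsetSum _ fun ν hν => ((tendsto_pochRatio hq0 hq1
      (mem_subdiagrams.1 hν)).mul_const _).mul (tendsto_schur X ν)
  simp only [one_mul] at h
  refine h.congr' ?_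
  filter_upwards [eventually_ge_atTop (μ.colLen 0)] with N hN
  rw [tabSum_boxWeight_eq_sum (qParam q N) X μ hN]
  refine sum_congr rfl fun ν hν => ?_
  rw [det_fallCoeff_qParam hq0 hq1 (mem_subdiagrams.1 hν) hN]

end QInterp

theorem theorem2 (q : ℝ) (hq0 : 0 < q) (hq1 : q < 1) (μ : YoungDiagram)
    (X : lp (fun _ : ℕ => ℝ) 1) :
    (Summable (fun T : QInterp.ReverseTableau μ => |QInterp.term q X T|) ∧
      HasSum (fun T : QInterp.ReverseTableau μ => QInterp.term q X T)
        (QInterp.eval (QInterp.interpolation q μ) X)) ∧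
    (Summable (fun p : QInterp.ReverseTableau μ × {A : Finset (ℕ × ℕ) // A ⊆ μ.cells} =>
        |QInterp.expandedTerm q X p.1 p.2.1|) ∧
      HasSum (fun p : QInterp.ReverseTableau μ × {A : Finset (ℕ × ℕ) // A ⊆ μ.cells} =>
        QInterp.expandedTerm q X p.1 p.2.1)
        (QInterp.eval (QInterp.interpolation q μ) X)) := by
  have hexp := QInterp.summable_abs_expandedTerm hq0 hq1 X μ
  have hsum := hexp.of_abs.hasSum
  have hterm := hsum.prod_fiberwise fun T => QInterp.hasSum_expandedTerm q X T
  have hlim := hterm.comp (QInterp.tendsto_bounded μ)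
  have heq := tendsto_nhds_unique hlim
    ((QInterp.tendsto_tabSum_interpolation hq0 hq1 μ X).congr fun N =>
      (QInterp.sum_term_bounded q X N μ).symm)
  rw [heq] at hsum hterm
  exact ⟨⟨hterm.summable.abs, hterm⟩, hexp, hsum⟩

end
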